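/- **Lemma (Clipped KDE score error).** Let $f^*$ be an arbitrary (possibly asymmetric, not necessarily absolutely continuous) probability distribution on $\mathbb{R}$ with finite variance $\sigma^2$. For $r>0$ let $w_r$ be the density of $\mathcal N(0,r^2)$, and let $f_r(x)=\mathbb E_{Y\sim f^*}[w_r(x-Y)]$ be the density of the $r$-smoothed distribution $f^* * \mathcal N(0,r^2)$, with score $s_r=f_r'/f_r$ and Fisher information $\mathcal I_r=\mathbb E_{x\sim f_r}[s_r(x)^2]$. For independent samples $Y_1,\dots,Y_N\sim f^*$ let $$\hat f_r(x)=\frac1N\sum_{i=1}^N w_r(x-Y_i),\qquad \hat s_r=\frac{\hat f_r'}{\hat f_r},\qquad \hat s_r^{\mathrm{clip}}(x)=\operatorname{sign}(\hat s_r(x))\cdot\min\left(|\hat s_r(x)|,\ \frac2r\sqrt{\log\frac{N}{\log\frac1\delta}}\right).$$ For every $\delta_0<1$ there are constants $C\ge 1$ and $K>0$, depending only on $\delta_0$ (so absolute constants if, say, $\delta\le 1/2$ is assumed), such that the following holds for all such $f^*$. Let $\gamma>C$, $0<r\le\sigma$, $\beta>0$, $0<\delta\le\delta_0$, and let $N$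 satisfy $$\frac{N}{\log\frac1\delta}\ \ge\ \left(\frac{\gamma^{5/12}\sigma}{r}\right)^{6+\beta}.$$ Then, with probability at least $1-\delta$ over $Y_1,\dots,Y_N$, the function $(\hat s_r^{\mathrm{clip}}-s_r)^2$ is integrable with respect to $f_r$ and $$\mathbb E_{x\sim f_r}\left[\left(\hat s_r^{\mathrm{clip}}(x)-s_r(x)\right)^2\right]\ \le\ K\,\frac{\mathcal I_r}{\gamma}.$$ -/

import Mathlib

open MeasureTheory ProbabilityTheory

noncomputable section

namespace ClippedKDE

/-- The density `w_r` of the Gaussian `𝒩(0, r²)`. -/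
def gaussianKernel (r x : ℝ) : ℝ :=
  gaussianPDFReal 0 (r ^ 2).toNNReal x

/-- The `r`-smoothed version of the distribution `P`, as a probability law: the law of `Y + Z`
with `Y ∼ P` and `Z ∼ 𝒩(0, r²)` independent. -/
def smoothedLaw (P : Measure ℝ) (r : ℝ) : Measure ℝ :=
  P ∗ gaussianReal 0 (r ^ 2).toNNReal

/-- The density `f_r(x) = 𝔼_{Y ∼ P} [w_r(x - Y)]` of the `r`-smoothed version of `P`. -/
def smoothedDensity (P : Measure ℝ) (r x : ℝ) : ℝ :=
  ∫ y, gaussianKernel r (x - y) ∂P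

/-- The score function `s_r = f_r' / f_r` of the `r`-smoothed version of `P`. -/
def smoothedScore (P : Measure ℝ) (r x : ℝ) : ℝ :=
  deriv (smoothedDensity P r) x / smoothedDensity P r x

/-- The `r`-smoothed Fisher information `𝓘_r = 𝔼_{x ∼ f_r} [s_r(x)²]`. -/
def smoothedFisherInfo (P : Measure ℝ) (r : ℝ) : ℝ :=
  ∫ x, smoothedScore P r x ^ 2 ∂(smoothedLaw P r)

/-- The Gaussian kernel density estimate built from the samples `Y₁, …, Y_N`. -/
def kde {N : ℕ} (Y : Fin N → ℝ) (r x : ℝ) : ℝ :=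
  (1 / (N : ℝ)) * ∑ i, gaussianKernel r (x - Y i)

/-- The score function of the kernel density estimate. -/
def kdeScore {N : ℕ} (Y : Fin N → ℝ) (r x : ℝ) : ℝ :=
  deriv (kde Y r) x / kde Y r x

/-- The clipped score of the kernel density estimate, with failure probability `δ`: the score
`kdeScore`, clipped in absolute value at `(2 / r) √(log (N / log (1 / δ)))`. -/
def clippedKDEScore {N : ℕ} (Y : Fin N → ℝ) (r δ x : ℝ) : ℝ :=
  Real.sign (kdeScore Y r x) *
    min |kdeScore Y r x| ((2 / r) * Real.sqrt (Real.log ((N : ℝ) / Real.log (1 / δ))))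

/-- The law `smoothedLaw P r` has density `smoothedDensity P r`. -/
theorem smoothedLaw_eq_withDensity (P : Measure ℝ) [IsProbabilityMeasure P] {r : ℝ}
    (hr : 0 < r) :
    smoothedLaw P r = volume.withDensity fun x => ENNReal.ofReal (smoothedDensity P r x) := by
  have hv : (r ^ 2).toNNReal ≠ 0 := by
    simpa using hr.ne'
  have hker : Measurable (gaussianKernel r) := measurable_gaussianPDFReal 0 _
  have hnn : ∀ z, 0 ≤ gaussianKernel r z := fun z => gaussianPDFReal_nonneg _ _ _
  have hint : ∀ x, Integrable (fun y => gaussianKernel r (x - y)) P := by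
    intro x
    refine Integrable.of_bound (C := (√(2 * Real.pi * (r ^ 2).toNNReal))⁻¹)
      (hker.comp (measurable_const.sub measurable_id)).aestronglyMeasurable
      (Filter.Eventually.of_forall fun y => ?_)
    rw [Real.norm_of_nonneg (hnn _)]
    unfold gaussianKernel gaussianPDFReal
    refine mul_le_of_le_one_right (by positivity) (Real.exp_le_one_iff.2 ?_)
    exact div_nonpos_of_nonpos_of_nonneg (neg_nonpos.2 (sq_nonneg _)) (by positivity)
  have hdens : ∀ x, ENNReal.ofReal (smoothedDensity P r x) =
      ∫⁻ y, ENNReal.ofReal (gaussianKernel r (x - y)) ∂P := fun x =>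
    ofReal_integral_eq_lintegral_ofReal (hint x) (Filter.Eventually.of_forall fun y => hnn _)
  ext s hs
  rw [smoothedLaw, ← lintegral_indicator_one hs,
    Measure.lintegral_conv (measurable_one.indicator hs), withDensity_apply _ hs,
    ← lintegral_indicator hs]
  have hlhs : ∀ y, ∫⁻ z, s.indicator (1 : ℝ → ENNReal) (y + z)
        ∂(gaussianReal 0 (r ^ 2).toNNReal) =
      ∫⁻ x, s.indicator 1 x * ENNReal.ofReal (gaussianKernel r (x - y)) := by
    intro y
    have hm : Measurable fun z : ℝ => s.indicator (1 : ℝ → ENNReal) (y + z) :=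
      (measurable_one.indicator hs).comp (measurable_const_add y)
    rw [gaussianReal_of_var_ne_zero _ hv,
      lintegral_withDensity_eq_lintegral_mul _ (measurable_gaussianPDF _ _) hm,
      ← lintegral_add_right_eq_self _ (-y)]
    refine lintegral_congr fun x => ?_
    have h1 : y + (x - y) = x := by ring
    simp only [Pi.mul_apply, gaussianPDF, gaussianKernel, ← sub_eq_add_neg, h1]
    rw [mul_comm]
  simp_rw [hlhs]
  rw [lintegral_lintegral_swap]
  · refine lintegral_congr fun x => ?_
    by_cases hx : x ∈ s
    · simp [hx, hdens]
    · simp [hx]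
  · refine Measurable.aemeasurable ?_
    have h1 : Measurable fun p : ℝ × ℝ => s.indicator (1 : ℝ → ENNReal) p.2 :=
      (measurable_one.indicator hs).comp measurable_snd
    have h2 : Measurable fun p : ℝ × ℝ => ENNReal.ofReal (gaussianKernel r (p.2 - p.1)) :=
      (hker.comp (measurable_snd.sub measurable_fst)).ennreal_ofReal
    exact h1.mul h2

end ClippedKDE

end

/-! Write u = (x - y)/r, g(x) = E exp(-u²/2), h(x) = E[u exp(-u²/2)] and m = h/g. Then s_r = -m/r,
and the kernel score is the same ratio of empirical means, so the problem is to estimate m in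
L²(f_r).

Both summands are bounded by 1 with second moment at most g. For fixed x with g(x) ≥ τ, Bernstein
gives deviations below 2√(gτ) outside an event of probability 4exp(-Nτ) (`measure_deviationSet_le`).
Fubini and Markov turn this into one event of probability 1 - δ on which the bad x with g(x) ≥ 16τ
have f_r-mass at most 1/n, where n = N/log(1/δ) (`measure_mass_deviationSet_ge_le`).

At a good x with g ≥ 16τ, (m̂ - m)² g ≤ 32τ(1 + m²) with m² ≤ 2 log(1/g) ≤ 2 log n
(`sq_ratio_sub_mul_le`, `sq_ratio_le_log`). Clipping can only help there, and integrating over |x -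
E Y| < T costs a factor T/r. The remaining x (tail, low density, deviation) form a set of small mass
p, on which the clipped error contributes O(p log n + 1/n), because m² has exponential tails under
f_r (`setLIntegral_sq_ratio_le`).

With T = σ n^(1/3) the total is O(n^(-2/5)), and the sample size hypothesis gives n^(2/5) ≥ γ(σ/r)².
Division by r² leaves O(1/(γσ²)), which is O(I_r/γ) by the Cramér–Rao bound I_r ≥ 1/(σ² + r²)
(`inv_le_smoothedFisherInfo`). -/

namespace ClippedKDE

/-! ### Gaussian weights, and both scores as ratios of their means -/

/-- The unnormalised Gaussian weight of scale `r` between `x` and `y`. -/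
noncomputable def weight (r x y : ℝ) : ℝ := Real.exp (-((x - y) / r) ^ 2 / 2)

/-- The weight multiplied by the standardised displacement. -/
noncomputable def tiltedWeight (r x y : ℝ) : ℝ := ((x - y) / r) * weight r x y

/-- The unnormalised smoothed density. -/
noncomputable def meanWeight (P : Measure ℝ) (r x : ℝ) : ℝ := ∫ y, weight r x y ∂P

/-- The unnormalised first moment of the standardised displacement. -/
noncomputable def meanTilted (P : Measure ℝ) (r x : ℝ) : ℝ := ∫ y, tiltedWeight r x y ∂P

/-- The empirical counterpart of `meanWeight`. -/
noncomputable def empWeight {N : ℕ} (Y : Fin N → ℝ) (r x : ℝ) : ℝ :=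
  (1 / (N : ℝ)) * ∑ i, weight r x (Y i)

/-- The empirical counterpart of `meanTilted`. -/
noncomputable def empTilted {N : ℕ} (Y : Fin N → ℝ) (r x : ℝ) : ℝ :=
  (1 / (N : ℝ)) * ∑ i, tiltedWeight r x (Y i)

/-- The normalising constant of the Gaussian density. -/
noncomputable def gaussConst (r : ℝ) : ℝ := (√(2 * Real.pi) * r)⁻¹

lemma gaussConst_pos {r : ℝ} (hr : 0 < r) : 0 < gaussConst r := by
  unfold gaussConst; positivity

lemma weight_pos (r x y : ℝ) : 0 < weight r x y := Real.exp_pos _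

lemma weight_le_one (r x y : ℝ) : weight r x y ≤ 1 :=
  Real.exp_le_one_iff.2 (by nlinarith [sq_nonneg ((x - y) / r)])

lemma weight_sq_le (r x y : ℝ) : weight r x y ^ 2 ≤ weight r x y := by
  nlinarith [weight_pos r x y, weight_le_one r x y]

lemma sq_mul_weight_le_one (r x y : ℝ) : ((x - y) / r) ^ 2 * weight r x y ≤ 1 := by
  unfold weight
  set u := (x - y) / r
  have h1 : u ^ 2 ≤ Real.exp (u ^ 2 / 2) := by
    have h2 := Real.add_one_le_exp (u ^ 2 / 4)
    have h3 : Real.exp (u ^ 2 / 2) = Real.exp (u ^ 2 / 4) ^ 2 := by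
      rw [← Real.exp_nat_mul]; congr 1; push_cast; ring
    rw [h3]
    nlinarith [sq_nonneg (u ^ 2 / 4 - 1), sq_nonneg u]
  calc u ^ 2 * Real.exp (-u ^ 2 / 2) ≤ Real.exp (u ^ 2 / 2) * Real.exp (-u ^ 2 / 2) := by gcongr
    _ = 1 := by rw [← Real.exp_add]; simp [neg_div]

/-- Together with `weight_sq_le`, this lets `meanWeight` serve as the variance proxy for both
statistics, so that deviations at x scale like √g(x). -/
lemma tiltedWeight_sq_le (r x y : ℝ) : tiltedWeight r x y ^ 2 ≤ weight r x y := by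
  have h : tiltedWeight r x y ^ 2 = (((x - y) / r) ^ 2 * weight r x y) * weight r x y := by
    unfold tiltedWeight; ring
  rw [h]
  exact mul_le_of_le_one_left (weight_pos r x y).le (sq_mul_weight_le_one r x y)

lemma abs_weight_le_one (r x y : ℝ) : |weight r x y| ≤ 1 := by
  rw [abs_of_pos (weight_pos r x y)]; exact weight_le_one r x y

lemma abs_tiltedWeight_le_one (r x y : ℝ) : |tiltedWeight r x y| ≤ 1 := by
  rw [← sq_le_one_iff_abs_le_one]
  exact (tiltedWeight_sq_le r x y).trans (weight_le_one r x y)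

lemma measurable_weight (r : ℝ) : Measurable fun p : ℝ × ℝ => weight r p.1 p.2 := by
  unfold weight; fun_prop

lemma measurable_tiltedWeight (r : ℝ) : Measurable fun p : ℝ × ℝ => tiltedWeight r p.1 p.2 := by
  unfold tiltedWeight weight; fun_prop

lemma measurable_weight_right (r x : ℝ) : Measurable (weight r x) := by
  unfold weight; fun_prop

lemma measurable_tiltedWeight_right (r x : ℝ) : Measurable (tiltedWeight r x) := by
  unfold tiltedWeight weight; fun_prop

lemma integrable_weight (P : Measure ℝ) [IsProbabilityMeasure P] (r x : ℝ) :
    Integrable (weight r x) P :=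
  Integrable.of_bound (measurable_weight_right r x).aestronglyMeasurable 1
    (Filter.Eventually.of_forall fun y => abs_weight_le_one r x y)

lemma integrable_tiltedWeight (P : Measure ℝ) [IsProbabilityMeasure P] (r x : ℝ) :
    Integrable (tiltedWeight r x) P :=
  Integrable.of_bound (measurable_tiltedWeight_right r x).aestronglyMeasurable 1
    (Filter.Eventually.of_forall fun y => abs_tiltedWeight_le_one r x y)

lemma meanWeight_pos (P : Measure ℝ) [IsProbabilityMeasure P] (r x : ℝ) :
    0 < meanWeight P r x := by
  refine (integral_pos_iff_support_of_nonneg (fun y => (weight_pos r x y).le)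
    (integrable_weight P r x)).2 ?_
  have : Function.support (weight r x) = Set.univ := by
    ext y; simp [(weight_pos r x y).ne']
  simp [this]

lemma measurable_meanWeight (P : Measure ℝ) [IsProbabilityMeasure P] (r : ℝ) :
    Measurable (meanWeight P r) :=
  (measurable_weight r).stronglyMeasurable.integral_prod_right.measurable

lemma measurable_meanTilted (P : Measure ℝ) [IsProbabilityMeasure P] (r : ℝ) :
    Measurable (meanTilted P r) :=
  (measurable_tiltedWeight r).stronglyMeasurable.integral_prod_right.measurable

lemma measurable_empWeight (N : ℕ) (r : ℝ) :
    Measurable fun p : (Fin N → ℝ) × ℝ => empWeight p.1 r p.2 := by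
  unfold empWeight weight; fun_prop

lemma measurable_empTilted (N : ℕ) (r : ℝ) :
    Measurable fun p : (Fin N → ℝ) × ℝ => empTilted p.1 r p.2 := by
  unfold empTilted tiltedWeight weight; fun_prop

lemma empWeight_pos {N : ℕ} (hN : 0 < N) (Y : Fin N → ℝ) (r x : ℝ) : 0 < empWeight Y r x := by
  have : Nonempty (Fin N) := ⟨⟨0, hN⟩⟩
  have h : 0 < ∑ i, weight r x (Y i) :=
    Finset.sum_pos (fun i _ => weight_pos r x (Y i)) Finset.univ_nonempty
  have hN' : (0 : ℝ) < N := by exact_mod_cast hN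
  unfold empWeight; positivity

lemma gaussianKernel_sub {r : ℝ} (hr : 0 < r) (x y : ℝ) :
    gaussianKernel r (x - y) = gaussConst r * weight r x y := by
  unfold gaussianKernel gaussianPDFReal gaussConst weight
  have h : √(2 * Real.pi * r ^ 2) = √(2 * Real.pi) * r := by
    rw [Real.sqrt_mul (by positivity), Real.sqrt_sq hr.le]
  rw [Real.coe_toNNReal _ (sq_nonneg r), h]
  congr 2
  field_simp
  ring

lemma hasDerivAt_gaussianKernel_sub {r : ℝ} (hr : 0 < r) (x y : ℝ) :
    HasDerivAt (fun x => gaussianKernel r (x - y)) (-(gaussConst r / r) * tiltedWeight r x y) x := by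
  have h1 : (fun x => gaussianKernel r (x - y)) = fun x => gaussConst r * weight r x y :=
    funext fun x => gaussianKernel_sub hr x y
  rw [h1]
  have h2 : HasDerivAt (fun x : ℝ => -((x - y) / r) ^ 2 / 2) (-((x - y) / r) / r) x := by
    have := ((((hasDerivAt_id x).sub_const y).div_const r).fun_pow 2).fun_neg.div_const 2
    refine this.congr_deriv ?_
    simp only [id_eq]
    push_cast
    ring
  have h3 := (h2.exp).const_mul (gaussConst r)
  refine h3.congr_deriv ?_
  unfold tiltedWeight weight
  ring

lemma smoothedDensity_eq (P : Measure ℝ) {r : ℝ} (hr : 0 < r) (x : ℝ) :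
    smoothedDensity P r x = gaussConst r * meanWeight P r x := by
  unfold smoothedDensity meanWeight
  simp_rw [gaussianKernel_sub hr, integral_const_mul]

lemma hasDerivAt_smoothedDensity (P : Measure ℝ) [IsProbabilityMeasure P] {r : ℝ} (hr : 0 < r)
    (x : ℝ) :
    HasDerivAt (smoothedDensity P r) (-(gaussConst r / r) * meanTilted P r x) x := by
  have hc : 0 ≤ gaussConst r / r := div_nonneg (gaussConst_pos hr).le hr.le
  have key := hasDerivAt_integral_of_dominated_loc_of_deriv_le (μ := P) (s := Set.univ)
    (x₀ := x) (F := fun x y => gaussianKernel r (x - y))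
    (F' := fun x y => -(gaussConst r / r) * tiltedWeight r x y)
    (bound := fun _ => gaussConst r / r) Filter.univ_mem ?_ ?_ ?_ ?_ ?_ ?_
  · have h := key.2
    rw [integral_const_mul] at h
    exact h
  · refine Filter.Eventually.of_forall fun x' => ?_
    simp_rw [gaussianKernel_sub hr]
    exact ((measurable_weight_right r x').const_mul _).aestronglyMeasurable
  · simp_rw [gaussianKernel_sub hr]
    exact (integrable_weight P r x).const_mul _
  · exact ((measurable_tiltedWeight_right r x).const_mul _).aestronglyMeasurable
  · refine Filter.Eventually.of_forall fun y x' _ => ?_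
    rw [norm_mul, norm_neg, Real.norm_of_nonneg hc]
    exact mul_le_of_le_one_right hc (abs_tiltedWeight_le_one r x' y)
  · exact integrable_const _
  · exact Filter.Eventually.of_forall fun y x' _ => hasDerivAt_gaussianKernel_sub hr x' y

lemma smoothedScore_eq (P : Measure ℝ) [IsProbabilityMeasure P] {r : ℝ} (hr : 0 < r) (x : ℝ) :
    smoothedScore P r x = -(1 / r) * (meanTilted P r x / meanWeight P r x) := by
  unfold smoothedScore
  rw [(hasDerivAt_smoothedDensity P hr x).deriv, smoothedDensity_eq P hr]
  have h1 := (gaussConst_pos hr).ne'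
  have h2 := (meanWeight_pos P r x).ne'
  field_simp

lemma kdeScore_eq {N : ℕ} (hN : 0 < N) (Y : Fin N → ℝ) {r : ℝ} (hr : 0 < r) (x : ℝ) :
    kdeScore Y r x = -(1 / r) * (empTilted Y r x / empWeight Y r x) := by
  have h0 : kde Y r x = gaussConst r * empWeight Y r x := by
    unfold kde empWeight
    simp_rw [gaussianKernel_sub hr, ← Finset.mul_sum]
    ring
  have hd : HasDerivAt (kde Y r) (-(gaussConst r / r) * empTilted Y r x) x := by
    have h := (HasDerivAt.fun_sum (u := Finset.univ) fun i _ =>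
      hasDerivAt_gaussianKernel_sub hr x (Y i)).const_mul (1 / (N : ℝ))
    refine h.congr_deriv ?_
    unfold empTilted
    rw [← Finset.mul_sum]
    ring
  unfold kdeScore
  rw [hd.deriv, h0]
  have h1 := (gaussConst_pos hr).ne'
  have h2 := (empWeight_pos hN Y r x).ne'
  field_simp

/-! ### Size of the population ratio m = h/g -/

/-- The normalised conditional mean displacement is bounded by the log-density. -/
lemma sq_ratio_le_log (P : Measure ℝ) [IsProbabilityMeasure P] (r x : ℝ) :
    (meanTilted P r x / meanWeight P r x) ^ 2 ≤ 2 * Real.log (1 / meanWeight P r x) := by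
  set g := meanWeight P r x with hg
  set h := meanTilted P r x with hh
  have hg0 : 0 < g := meanWeight_pos P r x
  set m := h / g with hm
  have hmg : m * g = h := div_mul_cancel₀ _ hg0.ne'
  -- Jensen for exp(u²/2) under the weighted law, in pointwise form: bounding 1 + m(u - m) by its
  -- exponential completes the square to exp(-(u - m)²/2) ≤ 1.
  have hpt : ∀ y, Real.exp (m ^ 2 / 2) * (m * tiltedWeight r x y + (1 - m ^ 2) * weight r x y)
      ≤ 1 := by
    intro y
    unfold tiltedWeight weight
    set u := (x - y) / r
    have h1 := Real.add_one_le_exp (m * (u - m))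
    have h2 : Real.exp (m ^ 2 / 2) * Real.exp (-u ^ 2 / 2) * Real.exp (m * (u - m)) ≤ 1 := by
      rw [← Real.exp_add, ← Real.exp_add]
      exact Real.exp_le_one_iff.2 (by nlinarith [sq_nonneg (u - m)])
    calc _ = Real.exp (m ^ 2 / 2) * Real.exp (-u ^ 2 / 2) * (m * (u - m) + 1) := by ring
      _ ≤ Real.exp (m ^ 2 / 2) * Real.exp (-u ^ 2 / 2) * Real.exp (m * (u - m)) := by gcongr
      _ ≤ 1 := h2
  have hi1 := (integrable_tiltedWeight P r x).const_mul m
  have hi2 := (integrable_weight P r x).const_mul (1 - m ^ 2)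
  have hint := integral_mono ((hi1.add hi2).const_mul (Real.exp (m ^ 2 / 2)))
    (integrable_const (1 : ℝ)) hpt
  rw [integral_const_mul] at hint
  simp only [Pi.add_apply] at hint
  rw [integral_add hi1 hi2, integral_const_mul, integral_const_mul] at hint
  change Real.exp (m ^ 2 / 2) * (m * h + (1 - m ^ 2) * g) ≤ _ at hint
  have he : m * h + (1 - m ^ 2) * g = g := by rw [← hmg]; ring
  rw [he] at hint
  simp at hint
  have h3 : Real.exp (m ^ 2 / 2) ≤ 1 / g := by rwa [le_div_iff₀ hg0]
  have h4 := (Real.le_log_iff_exp_le (by positivity)).2 h3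
  linarith

lemma integrable_exp_quarter (P : Measure ℝ) [IsProbabilityMeasure P] (r x : ℝ) :
    Integrable (fun y => Real.exp (-((x - y) / r) ^ 2 / 4)) P := by
  refine Integrable.of_bound (C := 1) (by fun_prop) (Filter.Eventually.of_forall fun y => ?_)
  rw [Real.norm_of_nonneg (Real.exp_pos _).le]
  exact Real.exp_le_one_iff.2 (by nlinarith [sq_nonneg ((x - y) / r)])

/-- Truncated second-moment bound for the ratio. -/
lemma sq_ratio_mul_le (P : Measure ℝ) [IsProbabilityMeasure P] (r x M : ℝ) :
    (meanTilted P r x / meanWeight P r x) ^ 2 * meanWeight P r x ≤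
      M * meanWeight P r x +
        4 * Real.exp (-M / 4) * ∫ y, Real.exp (-((x - y) / r) ^ 2 / 4) ∂P := by
  set g := meanWeight P r x with hg
  set h := meanTilted P r x with hh
  have hg0 : 0 < g := meanWeight_pos P r x
  set m := h / g with hm
  have hmg : m * g = h := div_mul_cancel₀ _ hg0.ne'
  -- Jensen enters as 2mu - m² ≤ u². Then u² - M ≤ 4 exp((u² - M)/4), which uses up half of the
  -- Gaussian exponent.
  have hpt : ∀ y, (2 * m) * tiltedWeight r x y + (- m ^ 2) * weight r x y ≤
      M * weight r x y + 4 * Real.exp (-M / 4) * Real.exp (-((x - y) / r) ^ 2 / 4) := by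
    intro y
    unfold tiltedWeight weight
    set u := (x - y) / r
    have hw := Real.exp_pos (-u ^ 2 / 2)
    have h1 := Real.add_one_le_exp ((u ^ 2 - M) / 4)
    have h2 : Real.exp (-M / 4) * Real.exp (-u ^ 2 / 4) =
        Real.exp ((u ^ 2 - M) / 4) * Real.exp (-u ^ 2 / 2) := by
      rw [← Real.exp_add, ← Real.exp_add]; congr 1; ring
    rw [mul_assoc 4, h2]
    nlinarith [mul_le_mul_of_nonneg_right h1 hw.le, mul_nonneg (sq_nonneg (u - m)) hw.le]
  have hi1 := (integrable_tiltedWeight P r x).const_mul (2 * m)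
  have hi2 := (integrable_weight P r x).const_mul (- m ^ 2)
  have hi3 := (integrable_weight P r x).const_mul M
  have hi4 := (integrable_exp_quarter P r x).const_mul (4 * Real.exp (-M / 4))
  have hint := integral_mono (hi1.add hi2) (hi3.add hi4) hpt
  simp only [Pi.add_apply] at hint
  rw [integral_add hi1 hi2, integral_add hi3 hi4, integral_const_mul, integral_const_mul,
    integral_const_mul, integral_const_mul] at hint
  change 2 * m * h + -m ^ 2 * g ≤ M * g + _ at hint
  have he : 2 * m * h + -m ^ 2 * g = m ^ 2 * g := by rw [← hmg]; ring
  linarith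

/-! ### Bernstein inequality -/

lemma integral_exp_mul_le (P : Measure ℝ) [IsProbabilityMeasure P] {X : ℝ → ℝ}
    (hX : Measurable X) (hb : ∀ y, |X y| ≤ 1) {v l : ℝ} (hv : ∫ y, X y ^ 2 ∂P ≤ v)
    (h0 : 0 ≤ l) (h1 : l ≤ 1) :
    ∫ y, Real.exp (l * X y) ∂P ≤ Real.exp (l * ∫ y, X y ∂P + l ^ 2 * v) := by
  have hiX : Integrable X P :=
    Integrable.of_bound hX.aestronglyMeasurable 1 (Filter.Eventually.of_forall hb)
  have hiX2 : Integrable (fun y => X y ^ 2) P := by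
    refine Integrable.of_bound (hX.pow_const 2).aestronglyMeasurable 1
      (Filter.Eventually.of_forall fun y => ?_)
    rw [Real.norm_of_nonneg (sq_nonneg _)]
    exact (sq_le_one_iff_abs_le_one _).2 (hb y)
  have hlX : ∀ y, |l * X y| ≤ 1 := fun y => by
    rw [abs_mul, abs_of_nonneg h0]
    exact mul_le_one₀ h1 (abs_nonneg _) (hb y)
  have hie : Integrable (fun y => Real.exp (l * X y)) P := by
    refine Integrable.of_bound (by fun_prop) (Real.exp 1) (Filter.Eventually.of_forall fun y => ?_)
    rw [Real.norm_of_nonneg (Real.exp_pos _).le]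
    exact Real.exp_le_exp.2 (abs_le.1 (hlX y)).2
  -- The bound exp z ≤ 1 + z + z² for |z| ≤ 1.
  have hpt : ∀ y, Real.exp (l * X y) ≤ (1 + l * X y) + l ^ 2 * X y ^ 2 := fun y => by
    have := (abs_le.1 (Real.abs_exp_sub_one_sub_id_le (hlX y))).2
    nlinarith
  have hi1 : Integrable (fun y => 1 + l * X y) P := (integrable_const _).add (hiX.const_mul l)
  have h := integral_mono hie (hi1.add (hiX2.const_mul (l ^ 2))) hpt
  simp only [Pi.add_apply] at h
  rw [integral_add hi1 (hiX2.const_mul _), integral_add (integrable_const _) (hiX.const_mul l),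
    integral_const_mul, integral_const_mul] at h
  simp only [integral_const, probReal_univ, smul_eq_mul, mul_one] at h
  have h2 := Real.add_one_le_exp (l * ∫ y, X y ∂P + l ^ 2 * v)
  nlinarith [mul_le_mul_of_nonneg_left hv (sq_nonneg l)]

/-- One-sided Bernstein inequality for the empirical mean of a bounded function. -/
lemma measure_empMean_ge_le (P : Measure ℝ) [IsProbabilityMeasure P] {X : ℝ → ℝ}
    (hX : Measurable X) (hb : ∀ y, |X y| ≤ 1) {v τ : ℝ} (hv : ∫ y, X y ^ 2 ∂P ≤ v)
    (hτ : 0 ≤ τ) (hτv : τ ≤ v) (hv0 : 0 < v) {N : ℕ} (hN : 0 < N) :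
    (Measure.pi fun _ : Fin N => P).real
      {Y | ∫ y, X y ∂P + 2 * √(v * τ) ≤ (1 / (N : ℝ)) * ∑ i, X (Y i)} ≤ Real.exp (-(N * τ)) := by
  have hN' : (0 : ℝ) < N := by exact_mod_cast hN
  -- This minimises the Chernoff exponent l²v - 2l√(vτ) per sample, with value -τ; the condition τ ≤
  -- v is what gives l ≤ 1.
  set l := √(τ / v) with hl
  have hl0 : 0 ≤ l := Real.sqrt_nonneg _
  have hl1 : l ≤ 1 := Real.sqrt_le_one.2 ((div_le_one hv0).2 hτv)
  have hl2 : l ^ 2 * v = τ := by rw [hl, Real.sq_sqrt (by positivity)]; field_simp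
  have hl3 : l * √(v * τ) = τ := by
    rw [hl, ← Real.sqrt_mul (by positivity), show τ / v * (v * τ) = τ ^ 2 by field_simp,
      Real.sqrt_sq hτ]
  set E := ∫ y, X y ∂P
  have hint : Integrable (fun Y : Fin N → ℝ => Real.exp (l * ∑ i, X (Y i)))
      (Measure.pi fun _ : Fin N => P) := by
    have hm : Measurable fun Y : Fin N → ℝ => Real.exp (l * ∑ i, X (Y i)) :=
      ((Finset.measurable_sum _ fun i _ => hX.comp (measurable_pi_apply i)).const_mul l).exp
    refine Integrable.of_bound (C := Real.exp N) hm.aestronglyMeasurable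
      (Filter.Eventually.of_forall fun Y => ?_)
    rw [Real.norm_of_nonneg (Real.exp_pos _).le, Real.exp_le_exp, Finset.mul_sum]
    calc ∑ i, l * X (Y i) ≤ ∑ _i : Fin N, (1 : ℝ) := Finset.sum_le_sum fun i _ => by
          have := (abs_le.1 (hb (Y i))).2
          nlinarith
      _ = N := by simp
  have hmgf : mgf (fun Y : Fin N → ℝ => ∑ i, X (Y i)) (Measure.pi fun _ : Fin N => P) l =
      (∫ y, Real.exp (l * X y) ∂P) ^ N := by
    unfold mgf
    simp_rw [Finset.mul_sum, Real.exp_sum]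
    rw [integral_fintype_prod_eq_pow (fun y => Real.exp (l * X y)), Fintype.card_fin]
  have h := measure_ge_le_exp_mul_mgf (μ := Measure.pi fun _ : Fin N => P)
    (X := fun Y : Fin N → ℝ => ∑ i, X (Y i)) (N * (E + 2 * √(v * τ))) hl0 hint
  have hset : {Y : Fin N → ℝ | E + 2 * √(v * τ) ≤ (1 / (N : ℝ)) * ∑ i, X (Y i)} =
      {Y | N * (E + 2 * √(v * τ)) ≤ ∑ i, X (Y i)} := by
    ext Y
    simp only [Set.mem_ofPred_eq]
    rw [one_div, inv_mul_eq_div, le_div_iff₀' hN']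
  rw [hset]
  refine h.trans ?_
  rw [hmgf]
  calc Real.exp (-l * (N * (E + 2 * √(v * τ)))) * (∫ y, Real.exp (l * X y) ∂P) ^ N
      ≤ Real.exp (-l * (N * (E + 2 * √(v * τ)))) * (Real.exp (l * E + l ^ 2 * v)) ^ N := by
        refine mul_le_mul_of_nonneg_left (pow_le_pow_left₀ ?_ ?_ N) (Real.exp_pos _).le
        · exact integral_nonneg_of_ae (Filter.Eventually.of_forall fun y => (Real.exp_pos _).le)
        · exact integral_exp_mul_le P hX hb hv hl0 hl1
    _ = Real.exp (-(N * τ)) := by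
        rw [← Real.exp_nat_mul, ← Real.exp_add]
        congr 1
        rw [hl2]
        linear_combination (-2 * (N : ℝ)) * hl3

lemma measure_abs_empMean_sub_ge_le (P : Measure ℝ) [IsProbabilityMeasure P] {X : ℝ → ℝ}
    (hX : Measurable X) (hb : ∀ y, |X y| ≤ 1) {v τ : ℝ} (hv : ∫ y, X y ^ 2 ∂P ≤ v)
    (hτ : 0 ≤ τ) (hτv : τ ≤ v) (hv0 : 0 < v) {N : ℕ} (hN : 0 < N) :
    (Measure.pi fun _ : Fin N => P).real
      {Y | 2 * √(v * τ) ≤ |(1 / (N : ℝ)) * ∑ i, X (Y i) - ∫ y, X y ∂P|} ≤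
        2 * Real.exp (-(N * τ)) := by
  have h1 := measure_empMean_ge_le P hX hb hv hτ hτv hv0 hN
  have h2 := measure_empMean_ge_le P hX.neg (fun y => by simpa using hb y) (v := v) (τ := τ)
    (by simpa using hv) hτ hτv hv0 hN
  have hsub : {Y : Fin N → ℝ | 2 * √(v * τ) ≤ |(1 / (N : ℝ)) * ∑ i, X (Y i) - ∫ y, X y ∂P|} ⊆
      {Y | ∫ y, X y ∂P + 2 * √(v * τ) ≤ (1 / (N : ℝ)) * ∑ i, X (Y i)} ∪
      {Y | ∫ y, (-X) y ∂P + 2 * √(v * τ) ≤ (1 / (N : ℝ)) * ∑ i, (-X) (Y i)} := by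
    intro Y hY
    simp only [Set.mem_ofPred_eq, Set.mem_union, Pi.neg_apply, integral_neg,
      Finset.sum_neg_distrib, mul_neg] at hY ⊢
    rcases le_abs.1 hY with h | h
    · left; linarith
    · right; linarith
  calc _ ≤ _ := measureReal_mono hsub
    _ ≤ _ := measureReal_union_le _ _
    _ ≤ _ := by linarith

/-! ### From fixed x to most x -/

/-- The samples for which the kernel estimates at `x` deviate from their means. -/
def deviationSet (P : Measure ℝ) (N : ℕ) (r τ : ℝ) : Set ((Fin N → ℝ) × ℝ) :=
  {p | 2 * √(meanWeight P r p.2 * τ) ≤ |empWeight p.1 r p.2 - meanWeight P r p.2| ∨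
    2 * √(meanWeight P r p.2 * τ) ≤ |empTilted p.1 r p.2 - meanTilted P r p.2|}

lemma measurableSet_deviationSet (P : Measure ℝ) [IsProbabilityMeasure P] (N : ℕ) (r τ : ℝ) :
    MeasurableSet (deviationSet P N r τ) := by
  have h1 : Measurable fun p : (Fin N → ℝ) × ℝ => meanWeight P r p.2 :=
    (measurable_meanWeight P r).comp measurable_snd
  have h2 : Measurable fun p : (Fin N → ℝ) × ℝ => meanTilted P r p.2 :=
    (measurable_meanTilted P r).comp measurable_snd
  have h3 := measurable_empWeight N r
  have h4 := measurable_empTilted N r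
  have h5 : Measurable fun p : (Fin N → ℝ) × ℝ => 2 * √(meanWeight P r p.2 * τ) :=
    ((h1.mul_const τ).sqrt).const_mul 2
  have ha : ∀ f : (Fin N → ℝ) × ℝ → ℝ, Measurable f → Measurable fun p => |f p| :=
    fun f hf => continuous_abs.measurable.comp hf
  exact (measurableSet_le h5 (ha _ (h3.sub h1))).union (measurableSet_le h5 (ha _ (h4.sub h2)))

lemma measure_deviationSet_le (P : Measure ℝ) [IsProbabilityMeasure P] {N : ℕ} (hN : 0 < N)
    {r τ x : ℝ} (hτ : 0 ≤ τ) (hx : τ ≤ meanWeight P r x) :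
    (Measure.pi fun _ : Fin N => P).real {Y | (Y, x) ∈ deviationSet P N r τ} ≤
      4 * Real.exp (-(N * τ)) := by
  have hi := integrable_weight P r x
  have hpos := meanWeight_pos P r x
  have h1 := measure_abs_empMean_sub_ge_le P (measurable_weight_right r x)
    (abs_weight_le_one r x) (v := meanWeight P r x)
    (integral_mono_of_nonneg (Filter.Eventually.of_forall fun _ => sq_nonneg _) hi
      (Filter.Eventually.of_forall (weight_sq_le r x))) hτ hx hpos hN
  have h2 := measure_abs_empMean_sub_ge_le P (measurable_tiltedWeight_right r x)
    (abs_tiltedWeight_le_one r x) (v := meanWeight P r x)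
    (integral_mono_of_nonneg (Filter.Eventually.of_forall fun _ => sq_nonneg _) hi
      (Filter.Eventually.of_forall (tiltedWeight_sq_le r x))) hτ hx hpos hN
  refine (measureReal_union_le _ _).trans ?_
  exact (add_le_add h1 h2).trans (by linarith)

/-- With high probability, the deviation set has small mass under any law `ν`. -/
lemma measure_mass_deviationSet_ge_le (P ν : Measure ℝ) [IsProbabilityMeasure P]
    [IsProbabilityMeasure ν] {N : ℕ} (hN : 0 < N) {r τ t ε : ℝ} (hτ : 0 ≤ τ) (ht : τ ≤ t)
    (hε : 0 < ε) :
    (Measure.pi fun _ : Fin N => P)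
      {Y | ENNReal.ofReal ε ≤ ν {x | t ≤ meanWeight P r x ∧ (Y, x) ∈ deviationSet P N r τ}} ≤
        ENNReal.ofReal (4 * Real.exp (-(N * τ)) / ε) := by
  set π := Measure.pi fun _ : Fin N => P
  set B : Set ((Fin N → ℝ) × ℝ) := {p | t ≤ meanWeight P r p.2} ∩ deviationSet P N r τ with hB
  have hBm : MeasurableSet B := (measurableSet_le measurable_const
    ((measurable_meanWeight P r).comp measurable_snd)).inter (measurableSet_deviationSet P N r τ)
  -- Fubini: the Bernstein bound holds on every slice with x fixed, so it bounds the product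
  -- measure; Markov over the samples then follows.
  have hprod : (π.prod ν) B ≤ ENNReal.ofReal (4 * Real.exp (-(N * τ))) := by
    rw [Measure.prod_apply_symm hBm]
    calc ∫⁻ x, π ((fun Y => (Y, x)) ⁻¹' B) ∂ν
        ≤ ∫⁻ _, ENNReal.ofReal (4 * Real.exp (-(N * τ))) ∂ν := by
          refine lintegral_mono fun x => ?_
          by_cases hx : t ≤ meanWeight P r x
          · have h := measure_deviationSet_le P hN hτ (ht.trans hx)
            have hsub : (fun Y => (Y, x)) ⁻¹' B ⊆ {Y | (Y, x) ∈ deviationSet P N r τ} :=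
              fun Y hY => hY.2
            refine (measure_mono hsub).trans ?_
            rw [← ofReal_measureReal (μ := π)]
            exact ENNReal.ofReal_le_ofReal h
          · have : (fun Y => (Y, x)) ⁻¹' B = ∅ := by
              ext Y
              simp [hB, hx]
            simp [this]
      _ = _ := by simp
  have hmk := meas_ge_le_lintegral_div (μ := π) (measurable_measure_prodMk_left (ν := ν) hBm).aemeasurable
    (ε := ENNReal.ofReal ε) (by simpa using hε) ENNReal.ofReal_ne_top
  rw [← Measure.prod_apply hBm] at hmk
  refine hmk.trans ?_
  rw [ENNReal.ofReal_div_of_pos hε]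
  gcongr

/-! ### Moments of the smoothed law and of the score -/

instance (P : Measure ℝ) [IsProbabilityMeasure P] (r : ℝ) :
    IsProbabilityMeasure (smoothedLaw P r) := by
  unfold smoothedLaw; infer_instance

lemma lintegral_smoothedLaw (P : Measure ℝ) [IsProbabilityMeasure P] {r : ℝ} (hr : 0 < r)
    {F : ℝ → ENNReal} (hF : Measurable F) :
    ∫⁻ x, F x ∂(smoothedLaw P r) =
      ∫⁻ x, ENNReal.ofReal (gaussConst r * meanWeight P r x) * F x := by
  rw [smoothedLaw_eq_withDensity P hr]
  simp_rw [smoothedDensity_eq P hr]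
  rw [lintegral_withDensity_eq_lintegral_mul _ _ hF]
  · rfl
  · exact ((measurable_meanWeight P r).const_mul _).ennreal_ofReal

lemma memLp_id_smoothedLaw {P : Measure ℝ} [IsProbabilityMeasure P] (hP : MemLp id 2 P) (r : ℝ) :
    MemLp id 2 (smoothedLaw P r) := by
  have hG : MemLp id 2 (gaussianReal 0 (r ^ 2).toNNReal) := by simpa using memLp_id_gaussianReal 2
  have hm : MeasurePreserving (fun p : ℝ × ℝ => p.1 + p.2)
      (P.prod (gaussianReal 0 (r ^ 2).toNNReal)) (smoothedLaw P r) :=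
    ⟨by fun_prop, rfl⟩
  rw [← hm.map_eq, memLp_map_measure_iff (by fun_prop) (by fun_prop)]
  exact (hP.comp_measurePreserving measurePreserving_fst).add
    (hG.comp_measurePreserving measurePreserving_snd)

lemma integral_id_smoothedLaw {P : Measure ℝ} [IsProbabilityMeasure P] (hP : MemLp id 2 P)
    (r : ℝ) : ∫ x, x ∂(smoothedLaw P r) = ∫ y, y ∂P := by
  have h1 : Integrable (fun x : ℝ => x) P := hP.integrable one_le_two
  have hG : Integrable (fun x : ℝ => x) (gaussianReal 0 (r ^ 2).toNNReal) :=
    (memLp_id_gaussianReal 1).integrable (by simp)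
  have h2 : Integrable (fun x : ℝ => x) (smoothedLaw P r) :=
    (memLp_id_smoothedLaw hP r).integrable one_le_two
  unfold smoothedLaw at h2 ⊢
  rw [integral_conv h2]
  have : ∀ y : ℝ, ∫ z, (y + z) ∂(gaussianReal 0 (r ^ 2).toNNReal) = y := fun y => by
    rw [integral_add (integrable_const _) hG]; simp
  simp_rw [this]

lemma variance_smoothedLaw {P : Measure ℝ} [IsProbabilityMeasure P] (hP : MemLp id 2 P) (r : ℝ) :
    variance id (smoothedLaw P r) = variance id P + r ^ 2 := by
  set G := gaussianReal 0 (r ^ 2).toNNReal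
  have hG : MemLp id 2 G := by simpa using memLp_id_gaussianReal 2
  have hm : smoothedLaw P r = (P.prod G).map (fun p : ℝ × ℝ => p.1 + p.2) := rfl
  have h1 : MemLp (fun p : ℝ × ℝ => p.1) 2 (P.prod G) :=
    hP.comp_measurePreserving measurePreserving_fst
  have h2 : MemLp (fun p : ℝ × ℝ => p.2) 2 (P.prod G) :=
    hG.comp_measurePreserving measurePreserving_snd
  have hind : IndepFun (fun p : ℝ × ℝ => p.1) (fun p : ℝ × ℝ => p.2) (P.prod G) :=
    indepFun_prod (X := id) (Y := id) measurable_id measurable_id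
  have e1 : variance (fun p : ℝ × ℝ => p.1) (P.prod G) = variance id P := by
    have := variance_map (X := id) (μ := P.prod G) (Y := Prod.fst) (by fun_prop) (by fun_prop)
    rw [measurePreserving_fst.map_eq] at this
    exact this.symm
  have e2 : variance (fun p : ℝ × ℝ => p.2) (P.prod G) = r ^ 2 := by
    have := variance_map (X := id) (μ := P.prod G) (Y := Prod.snd) (by fun_prop) (by fun_prop)
    rw [measurePreserving_snd.map_eq, variance_id_gaussianReal, Real.coe_toNNReal _ (sq_nonneg r)]
      at this
    exact this.symm
  rw [hm, variance_map (by fun_prop) (by fun_prop)]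
  change variance ((fun p : ℝ × ℝ => p.1) + fun p : ℝ × ℝ => p.2) (P.prod G) = _
  rw [hind.variance_add h1 h2, e1, e2]

/-- The mass of the truncated second moment of the score ratio over a set. -/
lemma setLIntegral_sq_ratio_le (P : Measure ℝ) [IsProbabilityMeasure P] {r : ℝ} (hr : 0 < r)
    {M : ℝ} (hM : 0 ≤ M) {A : Set ℝ} (hA : MeasurableSet A) :
    ∫⁻ x in A, ENNReal.ofReal ((meanTilted P r x / meanWeight P r x) ^ 2) ∂(smoothedLaw P r) ≤
      ENNReal.ofReal M * smoothedLaw P r A + ENNReal.ofReal (8 * Real.exp (-M / 4)) := by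
  have hκ := gaussConst_pos hr
  have hmw := measurable_meanWeight P r
  have hmt := measurable_meanTilted P r
  have hq : Measurable fun p : ℝ × ℝ => Real.exp (-((p.1 - p.2) / r) ^ 2 / 4) := by fun_prop
  have hk : Measurable fun x => ∫ y, Real.exp (-((x - y) / r) ^ 2 / 4) ∂P :=
    hq.stronglyMeasurable.integral_prod_right.measurable
  have hk0 : ∀ x, 0 ≤ ∫ y, Real.exp (-((x - y) / r) ^ 2 / 4) ∂P := fun x =>
    integral_nonneg fun y => (Real.exp_pos _).le
  have hgauss : ∀ y, ∫⁻ x, ENNReal.ofReal (Real.exp (-((x - y) / r) ^ 2 / 4)) =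
      ENNReal.ofReal (√(4 * Real.pi) * r) := by
    intro y
    have e : ∀ x : ℝ, Real.exp (-((x - y) / r) ^ 2 / 4) =
        Real.exp (-(1 / (4 * r ^ 2)) * (x - y) ^ 2) := fun x => by
      congr 1; field_simp
    have hi : Integrable fun x : ℝ => Real.exp (-(1 / (4 * r ^ 2)) * (x - y) ^ 2) :=
      (integrable_exp_neg_mul_sq (b := 1 / (4 * r ^ 2)) (by positivity)).comp_sub_right y
    simp_rw [e]
    rw [← ofReal_integral_eq_lintegral_ofReal hi
      (Filter.Eventually.of_forall fun x => (Real.exp_pos _).le),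
      integral_sub_right_eq_self (fun x : ℝ => Real.exp (-(1 / (4 * r ^ 2)) * x ^ 2)),
      integral_gaussian]
    congr 1
    rw [show Real.pi / (1 / (4 * r ^ 2)) = 4 * Real.pi * r ^ 2 by field_simp,
      Real.sqrt_mul (by positivity), Real.sqrt_sq hr.le]
  have hktot : ∫⁻ x, ENNReal.ofReal (∫ y, Real.exp (-((x - y) / r) ^ 2 / 4) ∂P) =
      ENNReal.ofReal (√(4 * Real.pi) * r) := by
    have : ∀ x, ENNReal.ofReal (∫ y, Real.exp (-((x - y) / r) ^ 2 / 4) ∂P) =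
        ∫⁻ y, ENNReal.ofReal (Real.exp (-((x - y) / r) ^ 2 / 4)) ∂P := fun x =>
      ofReal_integral_eq_lintegral_ofReal (integrable_exp_quarter P r x)
        (Filter.Eventually.of_forall fun y => (Real.exp_pos _).le)
    simp_rw [this]
    rw [lintegral_lintegral_swap hq.ennreal_ofReal.aemeasurable]
    simp_rw [hgauss]
    simp
  -- The ratio of the two Gaussian normalisations is √2, and 4√2 ≤ 8.
  have hconst : gaussConst r * (4 * Real.exp (-M / 4)) * (√(4 * Real.pi) * r) ≤
      8 * Real.exp (-M / 4) := by
    have h1 : √(4 * Real.pi) = √2 * √(2 * Real.pi) := by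
      rw [← Real.sqrt_mul (by norm_num)]; ring_nf
    have h2 : gaussConst r * (√(2 * Real.pi) * r) = 1 := by
      unfold gaussConst
      exact inv_mul_cancel₀ (by positivity)
    have h3 : √2 ≤ 2 := Real.sqrt_le_iff.2 ⟨by norm_num, by norm_num⟩
    calc _ = 4 * Real.exp (-M / 4) * √2 * (gaussConst r * (√(2 * Real.pi) * r)) := by
          rw [h1]; ring
      _ ≤ _ := by rw [h2]; nlinarith [Real.exp_pos (-M / 4)]
  have hm : Measurable fun x => ENNReal.ofReal ((meanTilted P r x / meanWeight P r x) ^ 2) :=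
    ((hmt.div hmw).pow_const 2).ennreal_ofReal
  rw [← lintegral_indicator hA, lintegral_smoothedLaw P hr (hm.indicator hA)]
  calc _ ≤ ∫⁻ x, (ENNReal.ofReal (gaussConst r * meanWeight P r x) *
          (A.indicator (fun _ => ENNReal.ofReal M) x) +
        ENNReal.ofReal (gaussConst r * (4 * Real.exp (-M / 4))) *
          ENNReal.ofReal (∫ y, Real.exp (-((x - y) / r) ^ 2 / 4) ∂P)) := by
        refine lintegral_mono fun x => ?_
        by_cases hx : x ∈ A
        · simp only [hx, Set.indicator_of_mem]
          have hg := (meanWeight_pos P r x).le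
          rw [← ENNReal.ofReal_mul (by positivity), ← ENNReal.ofReal_mul (by positivity),
            ← ENNReal.ofReal_mul (by positivity),
            ← ENNReal.ofReal_add (by positivity) (mul_nonneg (by positivity) (hk0 x))]
          refine ENNReal.ofReal_le_ofReal ?_
          have := mul_le_mul_of_nonneg_left (sq_ratio_mul_le P r x M) hκ.le
          linarith
        · simp [hx]
    _ = ENNReal.ofReal M * smoothedLaw P r A +
        ENNReal.ofReal (gaussConst r * (4 * Real.exp (-M / 4))) *
          ENNReal.ofReal (√(4 * Real.pi) * r) := by
        rw [lintegral_add_right _ (hk.ennreal_ofReal.const_mul _),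
          lintegral_const_mul _ hk.ennreal_ofReal, hktot,
          ← lintegral_smoothedLaw P hr (measurable_const.indicator hA),
          lintegral_indicator_const hA]
    _ ≤ _ := by
        rw [← ENNReal.ofReal_mul (by positivity)]
        gcongr

lemma measurable_smoothedScore (P : Measure ℝ) [IsProbabilityMeasure P] {r : ℝ} (hr : 0 < r) :
    Measurable (smoothedScore P r) := by
  rw [show smoothedScore P r = _ from funext (smoothedScore_eq P hr)]
  exact ((measurable_meanTilted P r).div (measurable_meanWeight P r)).const_mul _

lemma integrable_sq_smoothedScore (P : Measure ℝ) [IsProbabilityMeasure P] {r : ℝ} (hr : 0 < r) :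
    Integrable (fun x => smoothedScore P r x ^ 2) (smoothedLaw P r) := by
  -- Truncation level M = 0 on the whole line already shows that the Fisher information is finite.
  have h := setLIntegral_sq_ratio_le P hr le_rfl MeasurableSet.univ
  have h1 : Integrable (fun x => (meanTilted P r x / meanWeight P r x) ^ 2) (smoothedLaw P r) := by
    refine ⟨(((measurable_meanTilted P r).div
      (measurable_meanWeight P r)).pow_const 2).aestronglyMeasurable, ?_⟩
    rw [hasFiniteIntegral_iff_ofReal (Filter.Eventually.of_forall fun x => sq_nonneg _)]
    rw [Measure.restrict_univ] at h
    refine h.trans_lt ?_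
    simp
  simp_rw [smoothedScore_eq P hr, mul_pow]
  exact h1.const_mul _

/-! ### Cramér–Rao lower bound for the Fisher information -/

lemma gaussianPDFReal_zero_eq {r : ℝ} (hr : 0 < r) (z : ℝ) :
    gaussianPDFReal 0 (r ^ 2).toNNReal z = gaussConst r * weight r z 0 := by
  rw [← gaussianKernel_sub hr, sub_zero, gaussianKernel]

lemma weight_zero_eq {r : ℝ} (z : ℝ) :
    weight r z 0 = Real.exp (-(1 / (2 * r ^ 2)) * z ^ 2) := by
  unfold weight
  congr 1
  rw [sub_zero, div_pow]
  ring

lemma integral_mul_tiltedWeight_zero {r : ℝ} (hr : 0 < r) :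
    gaussConst r * ∫ z, z * tiltedWeight r z 0 = r := by
  have hv : (r ^ 2).toNNReal ≠ 0 := by simpa using hr.ne'
  have h := variance_id_gaussianReal (μ := 0) (v := (r ^ 2).toNNReal)
  rw [variance_of_integral_eq_zero (by fun_prop) (by simp),
    integral_gaussianReal_eq_integral_smul hv, Real.coe_toNNReal _ (sq_nonneg r)] at h
  simp_rw [gaussianPDFReal_zero_eq hr, smul_eq_mul, mul_assoc] at h
  rw [integral_const_mul] at h
  have e : ∫ z, weight r z 0 * id z ^ 2 = r * ∫ z, z * tiltedWeight r z 0 := by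
    rw [← integral_const_mul]
    refine integral_congr_ae (Filter.Eventually.of_forall fun z => ?_)
    simp only [tiltedWeight, id, sub_zero]
    field_simp
  rw [e] at h
  have : r * (gaussConst r * ∫ z, z * tiltedWeight r z 0) = r * r := by linarith
  exact mul_left_cancel₀ hr.ne' this

lemma integrable_tiltedWeight_zero {r : ℝ} (hr : 0 < r) :
    Integrable fun z => tiltedWeight r z 0 := by
  have h := (integrable_mul_exp_neg_mul_sq (b := 1 / (2 * r ^ 2)) (by positivity)).const_mul (1 / r)
  refine h.congr (Filter.Eventually.of_forall fun z => ?_)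
  simp only [tiltedWeight, weight_zero_eq, sub_zero]
  ring

lemma integrable_mul_tiltedWeight_zero {r : ℝ} (hr : 0 < r) :
    Integrable fun z => z * tiltedWeight r z 0 := by
  have h := (integrable_rpow_mul_exp_neg_mul_sq (b := 1 / (2 * r ^ 2)) (by positivity)
    (s := 2) (by norm_num)).const_mul (1 / r)
  refine h.congr (Filter.Eventually.of_forall fun z => ?_)
  simp only [tiltedWeight, weight_zero_eq, sub_zero, Real.rpow_two]
  ring

lemma tiltedWeight_add_left (r y z : ℝ) : tiltedWeight r (y + z) y = tiltedWeight r z 0 := by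
  simp [tiltedWeight, weight]

/-- Stein-type identity for the smoothed score. -/
lemma integral_smoothedScore_mul {P : Measure ℝ} [IsProbabilityMeasure P] (hP : MemLp id 2 P)
    {r : ℝ} (hr : 0 < r) :
    ∫ x, smoothedScore P r x * (x - ∫ y, y ∂P) ∂(smoothedLaw P r) = -1 := by
  set c := ∫ y, y ∂P with hc
  have hκ := gaussConst_pos hr
  have hiP : Integrable (fun y : ℝ => y - c) P :=
    (hP.integrable one_le_two).sub (integrable_const _)
  -- The shear x = y + z replaces integration by parts: x - c = z + (y - c), where the z part gives
  -- the Gaussian variance and the y - c part has mean zero under P.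
  have hmp : MeasurePreserving (fun p : ℝ × ℝ => (p.1, p.1 + p.2)) (P.prod volume)
      (P.prod volume) := measurePreserving_prod_add P volume
  set F : ℝ × ℝ → ℝ := fun p => tiltedWeight r p.2 p.1 * (p.2 - c) with hF
  have hFm : Measurable F :=
    ((measurable_tiltedWeight r).comp measurable_swap).mul (measurable_snd.sub_const c)
  have hFcomp : (fun p : ℝ × ℝ => F (p.1, p.1 + p.2)) =
      fun p => (1 : ℝ) * (p.2 * tiltedWeight r p.2 0) + (p.1 - c) * tiltedWeight r p.2 0 := by
    funext p
    simp only [hF, tiltedWeight_add_left]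
    ring
  have hi1 : Integrable (fun p : ℝ × ℝ => (1 : ℝ) * (p.2 * tiltedWeight r p.2 0))
      (P.prod volume) := Integrable.mul_prod (integrable_const (1 : ℝ))
    (integrable_mul_tiltedWeight_zero hr)
  have hi2 : Integrable (fun p : ℝ × ℝ => (p.1 - c) * tiltedWeight r p.2 0)
      (P.prod volume) := Integrable.mul_prod hiP (integrable_tiltedWeight_zero hr)
  have hFi : Integrable F (P.prod volume) := by
    rw [← hmp.integrable_comp hFm.aestronglyMeasurable]
    change Integrable (fun p : ℝ × ℝ => F (p.1, p.1 + p.2)) _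
    rw [hFcomp]
    exact hi1.add hi2
  have hFint : gaussConst r * ∫ p, F p ∂(P.prod volume) = r := by
    have e : ∫ p, F p ∂(P.prod volume) = ∫ p : ℝ × ℝ, F (p.1, p.1 + p.2) ∂(P.prod volume) := by
      conv_lhs => rw [← hmp.map_eq]
      rw [integral_map hmp.measurable.aemeasurable hFm.aestronglyMeasurable]
    have hz : ∫ y, (y - c) ∂P = 0 := by
      have hiy : Integrable (fun y : ℝ => y) P := hP.integrable one_le_two
      rw [integral_sub hiy (integrable_const _)]
      simp [hc]
    rw [e, hFcomp, integral_add hi1 hi2,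
      integral_prod_mul (fun _ : ℝ => (1 : ℝ)) (fun z => z * tiltedWeight r z 0),
      integral_prod_mul (fun y => y - c) (fun z => tiltedWeight r z 0), hz]
    simp [integral_mul_tiltedWeight_zero hr]
  rw [smoothedLaw_eq_withDensity P hr]
  simp_rw [smoothedDensity_eq P hr]
  rw [integral_withDensity_eq_integral_toReal_smul
    ((measurable_meanWeight P r).const_mul _).ennreal_ofReal
    (Filter.Eventually.of_forall fun _ => ENNReal.ofReal_lt_top)]
  have e : ∀ x, (ENNReal.ofReal (gaussConst r * meanWeight P r x)).toReal •
      (smoothedScore P r x * (x - c)) = -(1 / r) * gaussConst r * ∫ y, F (y, x) ∂P := by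
    intro x
    have hg := meanWeight_pos P r x
    rw [ENNReal.toReal_ofReal (by positivity), smoothedScore_eq P hr, smul_eq_mul]
    simp only [hF]
    rw [integral_mul_const]
    change _ = -(1 / r) * gaussConst r * (meanTilted P r x * (x - c))
    field_simp
  simp_rw [e]
  rw [integral_const_mul, ← integral_prod_symm F hFi, mul_assoc, hFint]
  field_simp

lemma inv_le_smoothedFisherInfo {P : Measure ℝ} [IsProbabilityMeasure P] (hP : MemLp id 2 P)
    {r : ℝ} (hr : 0 < r) :
    1 / (variance id P + r ^ 2) ≤ smoothedFisherInfo P r := by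
  set V := variance id P + r ^ 2 with hV
  have hV0 : 0 < V := by
    have := variance_nonneg id P
    positivity
  set c := ∫ y, y ∂P with hc
  set μ := smoothedLaw P r with hμ
  have hvar : ∫ x, (x - c) ^ 2 ∂μ = V := by
    rw [hV, ← variance_smoothedLaw hP r, variance_eq_integral (by fun_prop)]
    simp only [id, integral_id_smoothedLaw hP r]
    rfl
  have hL1 : MemLp (fun x => x - c) 2 μ := (memLp_id_smoothedLaw hP r).sub (memLp_const c)
  have hL2 : MemLp (smoothedScore P r) 2 μ :=
    (memLp_two_iff_integrable_sq (measurable_smoothedScore P hr).aestronglyMeasurable).2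
      (integrable_sq_smoothedScore P hr)
  have hi12 : Integrable (fun x => smoothedScore P r x * (x - c)) μ := hL2.integrable_mul hL1
  have hi1 : Integrable (fun x => (x - c) ^ 2) μ := hL1.integrable_sq
  have hi2 := integrable_sq_smoothedScore P hr
  -- Cauchy–Schwarz as the nonnegativity of E(s_r + (x - c)/V)², where the cross term is known from
  -- the Stein identity.
  have hnn : 0 ≤ ∫ x, (smoothedScore P r x ^ 2 + (2 / V * (smoothedScore P r x * (x - c)) +
      1 / V ^ 2 * (x - c) ^ 2)) ∂μ := by
    refine integral_nonneg_of_ae (Filter.Eventually.of_forall fun x => ?_)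
    have : smoothedScore P r x ^ 2 + (2 / V * (smoothedScore P r x * (x - c)) +
      1 / V ^ 2 * (x - c) ^ 2) = (smoothedScore P r x + (x - c) / V) ^ 2 := by ring_nf
    simp only [Pi.zero_apply, this]
    positivity
  have hi3 : Integrable (fun x => 2 / V * (smoothedScore P r x * (x - c)) +
      1 / V ^ 2 * (x - c) ^ 2) μ := (hi12.const_mul _).add (hi1.const_mul _)
  rw [integral_add hi2 hi3, integral_add (hi12.const_mul _) (hi1.const_mul _), integral_const_mul, integral_const_mul,
    hvar, integral_smoothedScore_mul hP hr] at hnn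
  change 0 ≤ smoothedFisherInfo P r + _ at hnn
  have : 2 / V * -1 + 1 / V ^ 2 * V = -(1 / V) := by field_simp; norm_num
  linarith

/-! ### Clipping, and the perturbation of a ratio -/

/-- Clipping of a real number at level `c`. -/
noncomputable def clip (c q : ℝ) : ℝ := Real.sign q * min |q| c

lemma abs_clip_le {c : ℝ} (hc : 0 ≤ c) (q : ℝ) : |clip c q| ≤ c := by
  unfold clip
  rw [abs_mul, abs_of_nonneg (le_min (abs_nonneg q) hc)]
  rcases Real.sign_apply_eq q with h | h | h <;> simp [h, hc]

/-- Clipping is the projection onto [-c, c], which does not increase the distance to a point of that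
interval. -/
lemma abs_clip_sub_le {c m : ℝ} (hm : |m| ≤ c) (q : ℝ) : |clip c q - m| ≤ |q - m| := by
  obtain ⟨h1, h2⟩ := abs_le.1 hm
  unfold clip
  rcases lt_trichotomy q 0 with h | h | h
  · rw [Real.sign_of_neg h, abs_of_neg h]
    rcases le_total (-q) c with h3 | h3
    · rw [min_eq_left h3]; simp
    · rw [min_eq_right h3, abs_of_nonpos (by linarith : q - m ≤ 0),
        abs_of_nonpos (by linarith)]
      linarith
  · simp [h]
  · rw [Real.sign_of_pos h, abs_of_pos h]
    rcases le_total q c with h3 | h3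
    · rw [min_eq_left h3]; simp
    · rw [min_eq_right h3, abs_of_nonneg (by linarith : 0 ≤ q - m), abs_of_nonneg (by linarith)]
      linarith

lemma measurable_clip (c : ℝ) : Measurable (clip c) := by
  have h : Measurable Real.sign :=
    Measurable.ite measurableSet_Iio measurable_const
      (Measurable.ite measurableSet_Ioi measurable_const measurable_const)
  exact h.mul ((continuous_abs.measurable).min measurable_const)

lemma clippedKDEScore_eq {N : ℕ} (hN : 0 < N) (Y : Fin N → ℝ) {r : ℝ} (hr : 0 < r) (δ x : ℝ) :
    clippedKDEScore Y r δ x =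
      -(1 / r) * clip (2 * √(Real.log ((N : ℝ) / Real.log (1 / δ))))
        (empTilted Y r x / empWeight Y r x) := by
  unfold clippedKDEScore clip
  rw [kdeScore_eq hN Y hr]
  set q := empTilted Y r x / empWeight Y r x
  set s := √(Real.log ((N : ℝ) / Real.log (1 / δ)))
  have hr' : 0 < 1 / r := by positivity
  have h1 : Real.sign (-(1 / r) * q) = -Real.sign q := by
    rcases lt_trichotomy q 0 with h | h | h
    · rw [Real.sign_of_neg h, Real.sign_of_pos (by nlinarith)]; simp
    · simp [h]
    · rw [Real.sign_of_pos h, Real.sign_of_neg (by nlinarith)]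
  have h2 : |-(1 / r) * q| = 1 / r * |q| := by
    rw [abs_mul, abs_neg, abs_of_pos hr']
  have h3 : 2 / r * s = 1 / r * (2 * s) := by ring
  rw [h1, h2, h3, ← mul_min_of_nonneg _ _ hr'.le]
  ring

/-- The condition 16τ ≤ g makes √(gτ) ≤ g/4, hence g' ≥ g/2. The error is then read off from (h'/g'
- m)g' = (h' - h) - m(g' - g). -/
lemma sq_ratio_sub_mul_le {g h g' h' τ : ℝ} (hg : 0 < g) (hτ : 0 ≤ τ) (ht : 16 * τ ≤ g)
    (h1 : |g' - g| ≤ 2 * √(g * τ)) (h2 : |h' - h| ≤ 2 * √(g * τ)) :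
    (h' / g' - h / g) ^ 2 * g ≤ 32 * τ * (1 + (h / g) ^ 2) := by
  set m := h / g with hm
  have hmg : m * g = h := div_mul_cancel₀ _ hg.ne'
  set s := √(g * τ) with hs
  have hs0 : 0 ≤ s := Real.sqrt_nonneg _
  have hs2 : s ^ 2 = g * τ := Real.sq_sqrt (by positivity)
  have hs4 : s ≤ g / 4 := abs_le_of_sq_le_sq' (by nlinarith) (by linarith) |>.2
  have hg' : g / 2 ≤ g' := by linarith [(abs_le.1 h1).1]
  have hg'0 : 0 < g' := by linarith
  have e : (h' / g' - m) * g' = (h' - h) - m * (g' - g) := by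
    rw [sub_mul, div_mul_cancel₀ _ hg'0.ne']
    linear_combination -hmg
  have hnum : ((h' - h) - m * (g' - g)) ^ 2 ≤ 8 * (g * τ) * (1 + m ^ 2) := by
    have a1 : (h' - h) ^ 2 ≤ 4 * (g * τ) := by
      have := sq_le_sq' (by linarith [(abs_le.1 h2).1]) (abs_le.1 h2).2
      nlinarith
    have a2 : (g' - g) ^ 2 ≤ 4 * (g * τ) := by
      have := sq_le_sq' (by linarith [(abs_le.1 h1).1]) (abs_le.1 h1).2
      nlinarith
    nlinarith [sq_nonneg ((h' - h) + m * (g' - g)), mul_le_mul_of_nonneg_left a2 (sq_nonneg m)]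
  rw [← e, mul_pow] at hnum
  have hgg : (g / 2) ^ 2 ≤ g' ^ 2 := by gcongr
  have h5 := (mul_le_mul_of_nonneg_left hgg (sq_nonneg (h' / g' - m))).trans hnum
  refine le_of_mul_le_mul_right ?_ hg
  nlinarith

/-! ### Integrating the error over good and exceptional points -/

lemma gaussConst_mul_two_mul_le {r T : ℝ} (hr : 0 < r) (hT : 0 ≤ T) :
    gaussConst r * (2 * T) ≤ T / r := by
  have h : 2 ≤ √(2 * Real.pi) := Real.le_sqrt_of_sq_le (by nlinarith [Real.pi_gt_three])
  unfold gaussConst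
  rw [inv_mul_eq_div, div_le_div_iff₀ (by positivity) hr]
  nlinarith [mul_le_mul_of_nonneg_right h (mul_nonneg hT hr.le)]

/-- A function dominated by `b / meanWeight` on a window has small integral there. -/
lemma setLIntegral_window_le (P : Measure ℝ) [IsProbabilityMeasure P] {r c T b : ℝ} (hr : 0 < r)
    (hT : 0 ≤ T) (hb : 0 ≤ b) {S : Set ℝ} (hS : MeasurableSet S)
    (hST : S ⊆ Set.Icc (c - T) (c + T)) {F : ℝ → ℝ} (hF : Measurable F)
    (hle : ∀ x ∈ S, F x * meanWeight P r x ≤ b) :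
    ∫⁻ x in S, ENNReal.ofReal (F x) ∂(smoothedLaw P r) ≤ ENNReal.ofReal (b * (T / r)) := by
  have hκ := gaussConst_pos hr
  rw [← lintegral_indicator hS, lintegral_smoothedLaw P hr (hF.ennreal_ofReal.indicator hS)]
  -- The factor `meanWeight` in the density is absorbed by the hypothesis on F, so only the Lebesgue
  -- length 2T of the window remains.
  calc _ ≤ ∫⁻ x, (Set.Icc (c - T) (c + T)).indicator
          (fun _ => ENNReal.ofReal (gaussConst r * b)) x := by
        refine lintegral_mono fun x => ?_
        by_cases hx : x ∈ S
        · have hg := (meanWeight_pos P r x).le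
          rw [Set.indicator_of_mem hx, Set.indicator_of_mem (hST hx),
            ← ENNReal.ofReal_mul (by positivity)]
          refine ENNReal.ofReal_le_ofReal ?_
          have := mul_le_mul_of_nonneg_left (hle x hx) hκ.le
          linarith
        · simp [hx]
    _ = ENNReal.ofReal (gaussConst r * b * (2 * T)) := by
        rw [lintegral_indicator_const measurableSet_Icc, Real.volume_Icc,
          ← ENNReal.ofReal_mul (by positivity)]
        ring_nf
    _ ≤ _ := by
        refine ENNReal.ofReal_le_ofReal ?_
        have := mul_le_mul_of_nonneg_left (gaussConst_mul_two_mul_le hr hT) hb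
        linarith

lemma smoothedLaw_tail_le {P : Measure ℝ} [IsProbabilityMeasure P] (hP : MemLp id 2 P) {r T : ℝ}
    (hT : 0 < T) :
    smoothedLaw P r {x | T ≤ |x - ∫ y, y ∂P|} ≤
      ENNReal.ofReal ((variance id P + r ^ 2) / T ^ 2) := by
  have h := meas_ge_le_variance_div_sq (memLp_id_smoothedLaw hP r) hT
  rw [variance_smoothedLaw hP r] at h
  simpa [integral_id_smoothedLaw hP r] using h

/-- The squared error of the clipped ratio of the kernel estimates. -/
noncomputable def clipError (P : Measure ℝ) {N : ℕ} (Y : Fin N → ℝ) (r n x : ℝ) : ℝ :=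
  (clip (2 * √(Real.log n)) (empTilted Y r x / empWeight Y r x) -
    meanTilted P r x / meanWeight P r x) ^ 2

lemma measurable_clipError (P : Measure ℝ) [IsProbabilityMeasure P] {N : ℕ} (Y : Fin N → ℝ)
    (r n : ℝ) : Measurable (clipError P Y r n) := by
  have h1 : Measurable fun x => empTilted Y r x := by
    unfold empTilted tiltedWeight weight; fun_prop
  have h2 : Measurable fun x => empWeight Y r x := by
    unfold empWeight weight; fun_prop
  exact (((measurable_clip _).comp (h1.div h2)).sub
    ((measurable_meanTilted P r).div (measurable_meanWeight P r))).pow_const 2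

/-- Needs no accuracy of the estimate: it serves on the exceptional set, where the clipping level is
all that controls the estimated score. -/
lemma clipError_le (P : Measure ℝ) {N : ℕ} (Y : Fin N → ℝ) (r x : ℝ) {n : ℝ} (hn : 1 ≤ n) :
    clipError P Y r n x ≤
      8 * Real.log n + 2 * (meanTilted P r x / meanWeight P r x) ^ 2 := by
  have hL0 : 0 ≤ Real.log n := Real.log_nonneg hn
  unfold clipError
  generalize empTilted Y r x / empWeight Y r x = q
  generalize meanTilted P r x / meanWeight P r x = m
  have h1 := abs_clip_le (c := 2 * √(Real.log n)) (by positivity) q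
  have h2 := sq_le_sq' (by linarith [(abs_le.1 h1).1]) (abs_le.1 h1).2
  rw [mul_pow, Real.sq_sqrt hL0] at h2
  nlinarith [sq_nonneg (clip (2 * √(Real.log n)) q + m)]

lemma clipError_mul_meanWeight_le (P : Measure ℝ) [IsProbabilityMeasure P] {N : ℕ}
    {Y : Fin N → ℝ} {r x n τ : ℝ} (hn : 1 ≤ n) (hτ : 1 / n ≤ 16 * τ)
    (hx : 16 * τ ≤ meanWeight P r x) (hY : (Y, x) ∉ deviationSet P N r τ) :
    clipError P Y r n x * meanWeight P r x ≤ 32 * τ * (1 + 2 * Real.log n) := by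
  have hn0 : 0 < n := by linarith
  have hL0 : 0 ≤ Real.log n := Real.log_nonneg hn
  have hτ0 : 0 ≤ τ := by
    have : 0 < 1 / n := by positivity
    linarith
  have h4 : ¬ (2 * √(meanWeight P r x * τ) ≤ |empWeight Y r x - meanWeight P r x| ∨
    2 * √(meanWeight P r x * τ) ≤ |empTilted Y r x - meanTilted P r x|) := hY
  push Not at h4
  have hg := meanWeight_pos P r x
  -- Here g ≥ 16τ ≥ 1/n, so m lies within the clipping level and clipping does no harm.
  have hm2 : (meanTilted P r x / meanWeight P r x) ^ 2 ≤ 2 * Real.log n := by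
    refine (sq_ratio_le_log P r x).trans ?_
    have : Real.log (1 / meanWeight P r x) ≤ Real.log n := by
      refine Real.log_le_log (by positivity) ?_
      rw [div_le_iff₀ hg]
      have := hτ.trans hx
      rwa [div_le_iff₀ hn0, mul_comm] at this
    linarith
  have hmabs : |meanTilted P r x / meanWeight P r x| ≤ 2 * √(Real.log n) := by
    refine abs_le_of_sq_le_sq ?_ (by positivity)
    rw [mul_pow, Real.sq_sqrt hL0]
    linarith
  have h5 := sq_le_sq.2 (abs_clip_sub_le hmabs (empTilted Y r x / empWeight Y r x))
  calc _ ≤ _ := mul_le_mul_of_nonneg_right h5 hg.le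
    _ ≤ _ := sq_ratio_sub_mul_le hg hτ0 hx h4.1.le h4.2.le
    _ ≤ _ := by gcongr

lemma setLIntegral_clipError_le (P : Measure ℝ) [IsProbabilityMeasure P] {N : ℕ}
    (Y : Fin N → ℝ) {r n p : ℝ} (hr : 0 < r) (hn : 1 ≤ n) (hp : 0 ≤ p) {A : Set ℝ}
    (hA : MeasurableSet A) (hAp : smoothedLaw P r A ≤ ENNReal.ofReal p) :
    ∫⁻ x in A, ENNReal.ofReal (clipError P Y r n x) ∂(smoothedLaw P r) ≤
      ENNReal.ofReal (16 * Real.log n * p + 16 / n) := by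
  have hn0 : 0 < n := by linarith
  have hL0 : 0 ≤ Real.log n := Real.log_nonneg hn
  have hmm : Measurable fun x => meanTilted P r x / meanWeight P r x :=
    (measurable_meanTilted P r).div (measurable_meanWeight P r)
  have hexp : Real.exp (-(4 * Real.log n) / 4) = 1 / n := by
    rw [show -(4 * Real.log n) / 4 = -Real.log n by ring, Real.exp_neg, Real.exp_log hn0, one_div]
  -- The level M = 4 log n makes exp(-M/4) equal to 1/n.
  have hs := setLIntegral_sq_ratio_le P hr (M := 4 * Real.log n) (by positivity) hA
  rw [hexp] at hs
  calc _ ≤ ∫⁻ x in A, (ENNReal.ofReal (8 * Real.log n) + ENNReal.ofReal 2 *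
          ENNReal.ofReal ((meanTilted P r x / meanWeight P r x) ^ 2)) ∂(smoothedLaw P r) := by
        refine lintegral_mono fun x => ?_
        rw [← ENNReal.ofReal_mul (by norm_num), ← ENNReal.ofReal_add (by positivity)
          (by positivity)]
        exact ENNReal.ofReal_le_ofReal (clipError_le P Y r x hn)
    _ = ENNReal.ofReal (8 * Real.log n) * smoothedLaw P r A + ENNReal.ofReal 2 *
        ∫⁻ x in A, ENNReal.ofReal ((meanTilted P r x / meanWeight P r x) ^ 2)
          ∂(smoothedLaw P r) := by
        rw [lintegral_add_left measurable_const,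
          lintegral_const_mul _ (hmm.pow_const 2).ennreal_ofReal, setLIntegral_const]
    _ ≤ ENNReal.ofReal (8 * Real.log n) * ENNReal.ofReal p + ENNReal.ofReal 2 *
        (ENNReal.ofReal (4 * Real.log n) * ENNReal.ofReal p + ENNReal.ofReal (8 * (1 / n))) := by
        gcongr
        exact hs.trans (by gcongr)
    _ = ENNReal.ofReal (16 * Real.log n * p + 16 / n) := by
        rw [← ENNReal.ofReal_mul (by positivity), ← ENNReal.ofReal_mul (by positivity),
          ← ENNReal.ofReal_add (by positivity) (by positivity),
          ← ENNReal.ofReal_mul (by positivity),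
          ← ENNReal.ofReal_add (by positivity) (by positivity)]
        ring_nf

lemma smoothedLaw_lowDensity_le (P : Measure ℝ) [IsProbabilityMeasure P] {r c T t : ℝ}
    (hr : 0 < r) (hT : 0 ≤ T) (ht : 0 ≤ t) :
    smoothedLaw P r {x | |x - c| < T ∧ meanWeight P r x < t} ≤ ENNReal.ofReal (t * (T / r)) := by
  have hm : MeasurableSet {x | |x - c| < T ∧ meanWeight P r x < t} :=
    (measurableSet_lt (f := fun x : ℝ => |x - c|) (by fun_prop) measurable_const).inter
      (measurableSet_lt (measurable_meanWeight P r) measurable_const)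
  have h := setLIntegral_window_le P (c := c) (b := t) hr hT ht hm
    (fun x hx => by
      have h1 : |x - c| < T := hx.1
      have := abs_lt.1 h1
      constructor <;> linarith [this.1, this.2]) (F := fun _ => 1) measurable_const
    (fun x hx => by
      have h1 : meanWeight P r x < t := hx.2
      rw [one_mul]
      exact h1.le)
  simpa using h

/-- Deterministic error bound, given that the deviation set has mass at most `1 / n`. -/
lemma lintegral_clipError_le {P : Measure ℝ} [IsProbabilityMeasure P] (hP : MemLp id 2 P)
    {r T τ n : ℝ} (hr : 0 < r) (hT : 0 < T) (hn : 1 ≤ n) (hτ : 1 / n ≤ 16 * τ) {N : ℕ}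
    (Y : Fin N → ℝ)
    (hY : smoothedLaw P r {x | 16 * τ ≤ meanWeight P r x ∧ (Y, x) ∈ deviationSet P N r τ} ≤
      ENNReal.ofReal (1 / n)) :
    ∫⁻ x, ENNReal.ofReal (clipError P Y r n x) ∂(smoothedLaw P r) ≤
      ENNReal.ofReal (32 * τ * (1 + 2 * Real.log n) * (T / r) + (16 * Real.log n *
        ((variance id P + r ^ 2) / T ^ 2 + 16 * τ * (T / r) + 1 / n) + 16 / n)) := by
  have hn0 : 0 < n := by linarith
  have hL0 : 0 ≤ Real.log n := Real.log_nonneg hn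
  have hτ0 : 0 ≤ τ := by
    have : 0 < 1 / n := by positivity
    linarith
  have hV0 := variance_nonneg id P
  set c := ∫ y, y ∂P with hc
  -- The exceptional points: `A1` is controlled by Chebyshev, `A2` by the window length, `A3` by the
  -- hypothesis on the sample.
  set A1 : Set ℝ := {x | T ≤ |x - c|} with hA1
  set A2 : Set ℝ := {x | |x - c| < T ∧ meanWeight P r x < 16 * τ} with hA2
  set A3 : Set ℝ := {x | 16 * τ ≤ meanWeight P r x ∧ (Y, x) ∈ deviationSet P N r τ} with hA3
  have hgm := measurable_meanWeight P r
  have habs : Measurable fun x : ℝ => |x - c| := by fun_prop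
  have hA1m : MeasurableSet A1 := measurableSet_le measurable_const habs
  have hA2m : MeasurableSet A2 :=
    (measurableSet_lt habs measurable_const).inter (measurableSet_lt hgm measurable_const)
  have hA3m : MeasurableSet A3 :=
    (measurableSet_le measurable_const hgm).inter
      (measurable_prodMk_left (measurableSet_deviationSet P N r τ))
  have hAm : MeasurableSet (A1 ∪ A2 ∪ A3) := (hA1m.union hA2m).union hA3m
  have hμA : smoothedLaw P r (A1 ∪ A2 ∪ A3) ≤ ENNReal.ofReal
      ((variance id P + r ^ 2) / T ^ 2 + 16 * τ * (T / r) + 1 / n) := by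
    rw [ENNReal.ofReal_add (by positivity) (by positivity),
      ENNReal.ofReal_add (by positivity) (by positivity)]
    refine (measure_union_le _ _).trans (add_le_add ((measure_union_le _ _).trans ?_) hY)
    exact add_le_add (smoothedLaw_tail_le hP hT)
      (smoothedLaw_lowDensity_le P hr hT.le (by positivity))
  have hbad := setLIntegral_clipError_le P Y hr hn (by positivity) hAm hμA
  have hgood : ∫⁻ x in (A1 ∪ A2 ∪ A3)ᶜ, ENNReal.ofReal (clipError P Y r n x) ∂(smoothedLaw P r) ≤
      ENNReal.ofReal (32 * τ * (1 + 2 * Real.log n) * (T / r)) := by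
    have hcore : ∀ x ∈ (A1 ∪ A2 ∪ A3)ᶜ, |x - c| < T ∧ 16 * τ ≤ meanWeight P r x ∧
        (Y, x) ∉ deviationSet P N r τ := by
      intro x hx
      have h1 : |x - c| < T := not_le.1 fun h => hx (Or.inl (Or.inl h))
      have h2 : 16 * τ ≤ meanWeight P r x := not_lt.1 fun h => hx (Or.inl (Or.inr ⟨h1, h⟩))
      exact ⟨h1, h2, fun h => hx (Or.inr ⟨h2, h⟩)⟩
    refine setLIntegral_window_le P (c := c) hr hT.le (by positivity) hAm.compl ?_
      (measurable_clipError P Y r n) ?_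
    · intro x hx
      have := abs_lt.1 (hcore x hx).1
      constructor <;> linarith [this.1, this.2]
    · intro x hx
      exact clipError_mul_meanWeight_le P hn hτ (hcore x hx).2.1 (hcore x hx).2.2
  rw [← lintegral_add_compl _ hAm, add_comm, ENNReal.ofReal_add (by positivity) (by positivity)]
  exact add_le_add hgood hbad

/-! ### Exponents and numerical constants -/

/-- The scale comparison between the sample size, the accuracy and the dimensionless width. -/
lemma mul_sq_le_pow_of_rpow_le {γ R β q : ℝ} (hγ : 1 ≤ γ) (hR : 1 ≤ R) (hβ : 0 < β)
    (hq : 0 ≤ q) (h : (γ ^ (5 / 12 : ℝ) * R) ^ (6 + β) ≤ q ^ 60) :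
    γ * R ^ 2 ≤ q ^ 24 ∧ R ≤ q ^ 10 ∧ γ ≤ q ^ 60 := by
  -- With a = γ^(1/12) and q = n^(1/60), every exponent below is an integer.
  set a := γ ^ (1 / 12 : ℝ) with ha
  have ha1 : 1 ≤ a := Real.one_le_rpow hγ (by norm_num)
  have hγa : γ = a ^ 12 := by
    rw [ha, ← Real.rpow_natCast, ← Real.rpow_mul (by linarith)]; norm_num
  have ha5 : γ ^ (5 / 12 : ℝ) = a ^ 5 := by
    rw [ha, ← Real.rpow_natCast, ← Real.rpow_mul (by linarith)]; norm_num
  rw [ha5] at h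
  have ha51 : 1 ≤ a ^ 5 := one_le_pow₀ ha1
  have hB1 : 1 ≤ a ^ 5 * R := by nlinarith
  have h6 : (a ^ 5 * R) ^ 6 ≤ q ^ 60 := by
    refine le_trans ?_ h
    rw [← Real.rpow_natCast]
    exact Real.rpow_le_rpow_of_exponent_le hB1 (by push_cast; linarith)
  have hBq : a ^ 5 * R ≤ q ^ 10 := by
    refine le_of_pow_le_pow_left₀ (n := 6) (by norm_num) (by positivity) ?_
    rw [← pow_mul]; exact h6
  refine ⟨?_, ?_, ?_⟩
  · refine le_of_pow_le_pow_left₀ (n := 5) (by norm_num) (by positivity) ?_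
    calc (γ * R ^ 2) ^ 5 = a ^ 60 * R ^ 10 := by rw [hγa]; ring
      _ ≤ a ^ 60 * R ^ 12 := by gcongr; norm_num
      _ = (a ^ 5 * R) ^ 12 := by ring
      _ ≤ (q ^ 10) ^ 12 := by gcongr
      _ = (q ^ 24) ^ 5 := by ring
  · nlinarith
  · calc γ = a ^ 12 * 1 := by rw [hγa, mul_one]
      _ ≤ a ^ 30 * R ^ 6 := by
        gcongr
        · norm_num
        · exact one_le_pow₀ hR
      _ = (a ^ 5 * R) ^ 6 := by ring
      _ ≤ q ^ 60 := h6

/-- The numerical error bound in terms of `q = n ^ (1 / 60)`. -/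
lemma error_terms_le {q L τ D R V T C₁ : ℝ} (hq : 1 ≤ q) (hL1 : 1 ≤ L) (hL : L ≤ 20 * q ^ 3)
    (hC₁ : 1 ≤ C₁) (hτ : τ ≤ C₁ * L / q ^ 60) (hD0 : 0 ≤ D)
    (hD : D = R * q ^ 20) (hR : R ≤ q ^ 10) (hV : V / T ^ 2 ≤ 2 / q ^ 40) :
    32 * τ * (1 + 2 * L) * D + (16 * L * (V / T ^ 2 + 16 * τ * D + 1 / q ^ 60) + 16 / q ^ 60) ≤
      166400 * C₁ / q ^ 24 := by
  have hq0 : 0 < q := by linarith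
  have hDq : D ≤ q ^ 30 := by
    rw [hD]
    calc R * q ^ 20 ≤ q ^ 10 * q ^ 20 := by gcongr
      _ = q ^ 30 := by ring
  have hτD : τ * D ≤ C₁ * L / q ^ 30 := by
    calc τ * D ≤ (C₁ * L / q ^ 60) * q ^ 30 := by gcongr
      _ = C₁ * L / q ^ 30 := by field_simp
  have h40 : 2 / q ^ 40 ≤ 2 / q ^ 30 := by gcongr; norm_num
  have h60 : 1 / q ^ 60 ≤ 1 / q ^ 30 := by gcongr; norm_num
  have h60' : 16 / q ^ 60 ≤ 16 / q ^ 30 := by gcongr; norm_num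
  have hLL : L ≤ C₁ * L ^ 2 := by nlinarith
  have hCL : C₁ ≤ C₁ * L ^ 2 := le_mul_of_one_le_right (by linarith) (one_le_pow₀ hL1)
  have hCL' : C₁ * L ≤ C₁ * L ^ 2 := by nlinarith
  calc 32 * τ * (1 + 2 * L) * D + (16 * L * (V / T ^ 2 + 16 * τ * D + 1 / q ^ 60) + 16 / q ^ 60)
      = 32 * (1 + 2 * L) * (τ * D) +
        (16 * L * (V / T ^ 2 + 16 * (τ * D) + 1 / q ^ 60) + 16 / q ^ 60) := by ring
    _ ≤ 32 * (1 + 2 * L) * (τ * D) +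
        (16 * L * (2 / q ^ 30 + 16 * (τ * D) + 1 / q ^ 30) + 16 / q ^ 30) := by
        have hV' := hV.trans h40
        have := mul_le_mul_of_nonneg_left (add_le_add (add_le_add hV' (le_refl (16 * (τ * D)))) h60)
          (show 0 ≤ 16 * L by linarith)
        linarith
    _ ≤ 32 * (1 + 2 * L) * (C₁ * L / q ^ 30) +
        (16 * L * (2 / q ^ 30 + 16 * (C₁ * L / q ^ 30) + 1 / q ^ 30) + 16 / q ^ 30) := by
        gcongr
    _ = (32 * (1 + 2 * L) * (C₁ * L) + (16 * L * (2 + 16 * (C₁ * L) + 1) + 16)) / q ^ 30 := by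
        ring
    -- Here 416 = 96 + 48 + 256 + 16 collects all terms as multiples of C₁L². The bound L ≤ 20q³
    -- then spends q⁶ on L², leaving q²⁴ of q³⁰.
    _ ≤ 416 * C₁ * (20 * q ^ 3) ^ 2 / q ^ 30 := by
        gcongr
        calc _ ≤ 416 * C₁ * L ^ 2 := by nlinarith
          _ ≤ _ := by gcongr
    _ = 166400 * C₁ / q ^ 24 := by field_simp; ring

/-- The deviation level attached to failure probability `δ`. -/
lemma deviation_level_le {δ δ₀ n : ℝ} (hδ : 0 < δ) (hδδ₀ : δ ≤ δ₀) (hδ₀ : δ₀ < 1) (hn : 8 ≤ n) :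
    (Real.log (1 / δ) + Real.log (4 * n)) / (n * Real.log (1 / δ)) ≤
      (1 + 2 / Real.log (1 / δ₀)) * Real.log n / n := by
  have hδ₀0 : 0 < δ₀ := hδ.trans_le hδδ₀
  have hc0 : 0 < Real.log (1 / δ₀) := Real.log_pos ((one_lt_div hδ₀0).2 hδ₀)
  have hcl : Real.log (1 / δ₀) ≤ Real.log (1 / δ) := Real.log_le_log (by positivity) (by gcongr)
  set c₀ := Real.log (1 / δ₀)
  set l := Real.log (1 / δ)
  have hl0 : 0 < l := hc0.trans_le hcl
  have hn0 : 0 < n := by linarith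
  have hL1 : 1 ≤ Real.log n := by
    rw [Real.le_log_iff_exp_le hn0]
    linarith [Real.exp_one_lt_d9]
  have h4 : Real.log (4 * n) ≤ 2 * Real.log n := by
    rw [Real.log_mul (by norm_num) hn0.ne']
    have : Real.log 4 ≤ Real.log n := Real.log_le_log (by norm_num) (by linarith)
    linarith
  calc (l + Real.log (4 * n)) / (n * l) = (1 + Real.log (4 * n) / l) / n := by field_simp
    -- The bound l ≥ c₀ is where the constant acquires its dependence on δ₀.
    _ ≤ (Real.log n + 2 * Real.log n / c₀) / n := by gcongr
    _ = (1 + 2 / c₀) * Real.log n / n := by ring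

lemma integrable_and_integral_le_of_lintegral_le {μ : Measure ℝ} {F : ℝ → ℝ} (hF : Measurable F)
    (h0 : ∀ x, 0 ≤ F x) {b : ℝ} (hb : 0 ≤ b) (h : ∫⁻ x, ENNReal.ofReal (F x) ∂μ ≤ ENNReal.ofReal b) :
    Integrable F μ ∧ ∫ x, F x ∂μ ≤ b := by
  refine ⟨⟨hF.aestronglyMeasurable, ?_⟩, ?_⟩
  · rw [hasFiniteIntegral_iff_ofReal (Filter.Eventually.of_forall h0)]
    exact h.trans_lt ENNReal.ofReal_lt_top
  · rw [integral_eq_lintegral_of_nonneg_ae (Filter.Eventually.of_forall h0)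
      hF.aestronglyMeasurable]
    exact ENNReal.toReal_le_of_le_ofReal hb h

lemma sq_clippedKDEScore_sub_eq (P : Measure ℝ) [IsProbabilityMeasure P] {N : ℕ} (hN : 0 < N)
    (Y : Fin N → ℝ) {r : ℝ} (hr : 0 < r) (δ x : ℝ) :
    (clippedKDEScore Y r δ x - smoothedScore P r x) ^ 2 =
      1 / r ^ 2 * clipError P Y r ((N : ℝ) / Real.log (1 / δ)) x := by
  rw [clippedKDEScore_eq hN Y hr, smoothedScore_eq P hr, clipError]
  ring

end ClippedKDE

/-! ### Choice of parameters and conclusion -/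

open ClippedKDE in
theorem mainTheorem3 (δ₀ : ℝ) (hδ₀ : δ₀ < 1) :
    ∃ C K : ℝ, 1 ≤ C ∧ 0 < K ∧
      ∀ (P : Measure ℝ) [IsProbabilityMeasure P]
        (σ r γ β δ : ℝ) (N : ℕ),
        MemLp id 2 P → variance id P = σ ^ 2 →
        0 < r → r ≤ σ → C < γ → 0 < β → 0 < δ → δ ≤ δ₀ →
        (γ ^ (5 / 12 : ℝ) * σ / r) ^ (6 + β) ≤ (N : ℝ) / Real.log (1 / δ) →
        ENNReal.ofReal (1 - δ) ≤ Measure.pi (fun _ : Fin N => P)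
          {Y | Integrable
                (fun x => (ClippedKDE.clippedKDEScore Y r δ x - ClippedKDE.smoothedScore P r x) ^ 2)
                (ClippedKDE.smoothedLaw P r) ∧
              ∫ x, (ClippedKDE.clippedKDEScore Y r δ x - ClippedKDE.smoothedScore P r x) ^ 2
                ∂(ClippedKDE.smoothedLaw P r) ≤ K * (ClippedKDE.smoothedFisherInfo P r / γ)} := by
  rcases le_or_gt δ₀ 0 with h0 | h0
  -- No δ satisfies 0 < δ ≤ δ₀ in this case.
  · refine ⟨1, 1, le_rfl, one_pos, ?_⟩
    intro P _ σ r γ β δ N _ _ _ _ _ _ hδ hδδ₀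
    linarith
  have hc0 : 0 < Real.log (1 / δ₀) := Real.log_pos ((one_lt_div h0).2 hδ₀)
  set C₁ := 1 + 2 / Real.log (1 / δ₀) with hC₁
  have hC₁1 : 1 ≤ C₁ := by
    have : 0 < 2 / Real.log (1 / δ₀) := by positivity
    linarith
  -- γ > 8 forces n ≥ 8, hence log n ≥ 1 and log 4 ≤ log n. The value 332800 is 2 · 166400, the 2
  -- coming from σ² + r² ≤ 2σ².
  refine ⟨8, 332800 * C₁, by norm_num, by positivity, ?_⟩
  intro P _ σ r γ β δ N hP hσ hr hrσ hγ hβ hδ hδδ₀ hN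
  have hσ0 : 0 < σ := hr.trans_le hrσ
  have hl0 : 0 < Real.log (1 / δ) := Real.log_pos ((one_lt_div hδ).2 (hδδ₀.trans_lt hδ₀))
  set n := (N : ℝ) / Real.log (1 / δ) with hn
  have hnN : n * Real.log (1 / δ) = N := div_mul_cancel₀ _ hl0.ne'
  set q := n ^ (1 / 60 : ℝ) with hq
  have hn00 : 0 ≤ n := div_nonneg (Nat.cast_nonneg N) hl0.le
  have hnq : n = q ^ 60 := by
    rw [hq, ← Real.rpow_natCast, ← Real.rpow_mul hn00]; norm_num
  have hq0 : 0 ≤ q := Real.rpow_nonneg hn00 _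
  have hR1 : 1 ≤ σ / r := (one_le_div hr).2 hrσ
  obtain ⟨hA, hB, hγq⟩ := mul_sq_le_pow_of_rpow_le (γ := γ) (R := σ / r) (by linarith) hR1 hβ hq0
    (by rw [← hnq, ← mul_div_assoc]; exact hN)
  have hn8 : 8 ≤ n := by rw [hnq]; linarith
  have hn0 : 0 < n := by linarith
  have hq1 : 1 ≤ q := Real.one_le_rpow (by linarith) (by norm_num)
  have hqpos : 0 < q := by linarith
  have hNpos : 0 < N := by
    have : (0 : ℝ) < N := by rw [← hnN]; positivity
    exact_mod_cast this
  have hL1 : 1 ≤ Real.log n := by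
    rw [Real.le_log_iff_exp_le hn0]
    linarith [Real.exp_one_lt_d9]
  have hLq : Real.log n ≤ 20 * q ^ 3 := by
    have h1 : Real.log n = 20 * Real.log (q ^ 3) := by
      rw [hnq, Real.log_pow, Real.log_pow]; push_cast; ring
    have h2 := Real.log_le_sub_one_of_pos (show 0 < q ^ 3 by positivity)
    linarith
  -- Chosen so that the Markov bound 4exp(-Nτ)/(1/n) equals δ exactly.
  set τ := (Real.log (1 / δ) + Real.log (4 * n)) / N with hτ
  have h4n : 0 ≤ Real.log (4 * n) := Real.log_nonneg (by linarith)
  have hNR : (0 : ℝ) < N := by exact_mod_cast hNpos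
  have hτ0 : 0 ≤ τ := by positivity
  have hτle : τ ≤ C₁ * Real.log n / q ^ 60 := by
    rw [← hnq, hτ, ← hnN]
    exact deviation_level_le hδ hδδ₀ hδ₀ hn8
  have hτge : 1 / n ≤ 16 * τ := by
    have h1 : 1 / n = Real.log (1 / δ) / N := by rw [← hnN]; field_simp
    have h2 : Real.log (1 / δ) / N ≤ τ := by
      rw [hτ]; gcongr; linarith
    linarith
  have hexp : 4 * Real.exp (-(N * τ)) / (1 / n) = δ := by
    rw [hτ, mul_div_cancel₀ _ hNR.ne', neg_add, Real.exp_add, Real.exp_neg, Real.exp_neg,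
      Real.exp_log (by positivity), Real.exp_log (by positivity)]
    field_simp
  -- T = σ n^(1/3): the tail mass is at most 2q⁻⁴⁰, while T/r ≤ q³⁰ keeps τT/r of order q⁻³⁰ log n.
  set T := σ * q ^ 20 with hT
  have hT0 : 0 < T := by positivity
  set V := variance id P + r ^ 2 with hV
  have hV2 : V ≤ 2 * σ ^ 2 := by
    rw [hV, hσ]; nlinarith
  have hV0 : 0 < V := by rw [hV, hσ]; positivity
  have hVT : V / T ^ 2 ≤ 2 / q ^ 40 := by
    calc V / T ^ 2 ≤ 2 * σ ^ 2 / T ^ 2 := by gcongr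
      _ = 2 / q ^ 40 := by rw [hT]; field_simp
  have hterms := error_terms_le (D := T / r) hq1 hL1 hLq hC₁1 hτle (by positivity)
    (by rw [hT]; ring) hB hVT
  rw [← hnq] at hterms
  -- Replacing q²⁴ by γ(σ/r)² cancels r², and Cramér–Rao converts 1/σ² into Fisher information.
  have hfinal : 1 / r ^ 2 * (166400 * C₁ / q ^ 24) ≤
      332800 * C₁ * (smoothedFisherInfo P r / γ) := by
    have hγ0 : 0 < γ := by linarith
    calc 1 / r ^ 2 * (166400 * C₁ / q ^ 24)
        ≤ 1 / r ^ 2 * (166400 * C₁ / (γ * (σ / r) ^ 2)) := by gcongr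
      _ = 332800 * C₁ * (1 / (2 * σ ^ 2) / γ) := by field_simp; norm_num
      _ ≤ 332800 * C₁ * (1 / V / γ) := by gcongr
      _ ≤ _ := by gcongr; exact inv_le_smoothedFisherInfo hP hr
  set bad : Set (Fin N → ℝ) := {Y | ENNReal.ofReal (1 / n) ≤ smoothedLaw P r
    {x | 16 * τ ≤ meanWeight P r x ∧ (Y, x) ∈ deviationSet P N r τ}} with hbad
  have hbadle : (Measure.pi fun _ : Fin N => P) bad ≤ ENNReal.ofReal δ := by
    have h := measure_mass_deviationSet_ge_le P (smoothedLaw P r) hNpos (r := r) (τ := τ)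
      (t := 16 * τ) (ε := 1 / n) hτ0 (by linarith) (by positivity)
    rwa [hexp] at h
  have hcompl : ENNReal.ofReal (1 - δ) ≤ (Measure.pi fun _ : Fin N => P) badᶜ := by
    have h1 : (1 : ENNReal) ≤ (Measure.pi fun _ : Fin N => P) bad +
        (Measure.pi fun _ : Fin N => P) badᶜ := by
      rw [← measure_univ (μ := Measure.pi fun _ : Fin N => P), ← Set.union_compl_self bad]
      exact measure_union_le _ _
    rw [ENNReal.ofReal_sub _ hδ.le, ENNReal.ofReal_one]
    exact tsub_le_iff_left.2 (h1.trans (by gcongr))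
  refine hcompl.trans (measure_mono fun Y hY => ?_)
  have hYle := (not_le.1 (show ¬ ENNReal.ofReal (1 / n) ≤ _ from hY)).le
  have hlin := lintegral_clipError_le hP hr hT0 (by linarith) hτge Y hYle
  have hlin2 := hlin.trans (ENNReal.ofReal_le_ofReal hterms)
  obtain ⟨hi, hle⟩ := integrable_and_integral_le_of_lintegral_le (measurable_clipError P Y r n)
    (fun x => sq_nonneg _) (by positivity) hlin2
  have heq : (fun x => (clippedKDEScore Y r δ x - smoothedScore P r x) ^ 2) =
      fun x => 1 / r ^ 2 * clipError P Y r n x :=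
    funext fun x => sq_clippedKDEScore_sub_eq P hNpos Y hr δ x
  change Integrable (fun x => (clippedKDEScore Y r δ x - smoothedScore P r x) ^ 2)
    (smoothedLaw P r) ∧ ∫ x, (fun x => (clippedKDEScore Y r δ x - smoothedScore P r x) ^ 2) x
      ∂(smoothedLaw P r) ≤ _
  rw [heq]
  refine ⟨hi.const_mul _, ?_⟩
  rw [integral_const_mul]
  refine le_trans ?_ hfinal
  gcongr
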